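/- An equiangular set of lines in a Euclidean space is a set of lines through the origin any two distinct members of which form the same angle $\theta\in[0,\frac{\pi}{2}]$. Let $t_n$ (resp. $t'_n$) be the maximal cardinality of an equiangular set of lines contained in (resp. spanning) an $n$-dimensional Euclidean space. For a (full) lattice $\Lambda$ in a Euclidean space let $S(\Lambda)$ be the set of its minimal vectors, that is, of its nonzero vectors of smallest length; the lines defined by $\Lambda$ are the lines $\mathbb{R}x$, $x\in S(\Lambda)$. Let $A_3=\{x\in\mathbb{Z}^4 : x_0+x_1+x_2+x_3=0\}$, and let $A_3^*$ be its dual lattice in the $3$-dimensional space that $A_3$ spans. **Proposition.** 1. For $2\le n\le 7$ we have $t'_n=t_n$. Moreover, for $2\le n\le 7$ and $n\neq 3$ there is a lattice in $\mathbb{R}^n$ the lines of which are equiangular, span $\mathbb{R}^n$, and are $t'_n$ in number; for $n=3$ there is no such lattice. 2. The maximal number of lines defined by a lattice in $\mathbb{R}^3$ whose lines are equiangular is $4$. This value is attained uniquely on the configuration of $S(A_3^*)$: a lattice $\Lambda$ in $\mathbb{R}^3$ defines exactly $4$ lines and these are equiangular if and only if $S(\Lambda)$ is the image of $S(A_3^*)$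 under a linear isometry followed by a scaling by a positive factor. 3. For $8\le n\le 13$ we have $t'_n<t_n=28$. -/

import Mathlib

open scoped RealInnerProductSpace

/-- A set `X` of lines through the origin of a Euclidean space is equiangular: there is an angle
`θ ∈ [0, π/2]` which is the (unoriented) angle between any two distinct lines of `X`. -/
def IsEquiangular {E : Type*} [NormedAddCommGroup E] [InnerProductSpace ℝ E]
    (X : Set (Submodule ℝ E)) : Prop :=
  (∀ L ∈ X, Module.finrank ℝ L = 1) ∧
    ∃ θ ∈ Set.Icc (0 : ℝ) (Real.pi / 2), ∀ L ∈ X, ∀ M ∈ X, L ≠ M →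
      ∀ x ∈ L, ∀ y ∈ M, |⟪x, y⟫| = ‖x‖ * ‖y‖ * Real.cos θ

/-- `t_n`: the maximal cardinality of an equiangular set of lines contained in an `n`-dimensional
Euclidean space. The supremum is taken in `ℕ∞`, so that it has no junk value. -/
noncomputable def maxEquiangular (n : ℕ) : ℕ∞ :=
  sSup {k | ∃ X : Set (Submodule ℝ (EuclideanSpace ℝ (Fin n))),
    IsEquiangular X ∧ X.encard = k}

/-- `t'_n`: the maximal cardinality of an equiangular set of lines spanning an `n`-dimensional
Euclidean space. -/
noncomputable def maxSpanningEquiangular (n : ℕ) : ℕ∞ :=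
  sSup {k | ∃ X : Set (Submodule ℝ (EuclideanSpace ℝ (Fin n))),
    IsEquiangular X ∧ sSup X = ⊤ ∧ X.encard = k}

/-- `Λ` is a (full) lattice in the Euclidean space `E`: a discrete subgroup spanning `E`. -/
def IsFullLattice {E : Type*} [NormedAddCommGroup E] [InnerProductSpace ℝ E]
    (Λ : Submodule ℤ E) : Prop :=
  ∃ _ : DiscreteTopology Λ, IsZLattice ℝ Λ

/-- The set `S(Λ)` of minimal vectors of `Λ`: its nonzero vectors of smallest length. -/
def minimalVectors {E : Type*} [NormedAddCommGroup E] [InnerProductSpace ℝ E]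
    (Λ : Submodule ℤ E) : Set E :=
  {x | x ∈ Λ ∧ x ≠ 0 ∧ ∀ y ∈ Λ, y ≠ 0 → ‖x‖ ≤ ‖y‖}

/-- The set of lines supported by the minimal vectors of `Λ`. -/
def minimalLines {E : Type*} [NormedAddCommGroup E] [InnerProductSpace ℝ E]
    (Λ : Submodule ℤ E) : Set (Submodule ℝ E) :=
  (fun x : E => Submodule.span ℝ {x}) '' minimalVectors Λ

/-- The dual lattice `Λ* = {x ∈ E | ∀ y ∈ Λ, x · y ∈ ℤ}`. -/
def dualLattice {E : Type*} [NormedAddCommGroup E] [InnerProductSpace ℝ E]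
    (Λ : Submodule ℤ E) : Submodule ℤ E where
  carrier := {x | ∀ y ∈ Λ, ∃ k : ℤ, ⟪x, y⟫ = k}
  zero_mem' := fun y _ => ⟨0, by simp⟩
  add_mem' := by
    intro a b ha hb y hy
    obtain ⟨k, hk⟩ := ha y hy
    obtain ⟨l, hl⟩ := hb y hy
    exact ⟨k + l, by rw [inner_add_left, hk, hl]; push_cast; rfl⟩
  smul_mem' := by
    intro c x hx y hy
    obtain ⟨k, hk⟩ := hx y hy
    refine ⟨c * k, ?_⟩
    rw [← Int.cast_smul_eq_zsmul ℝ c x, real_inner_smul_left, hk]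
    push_cast
    rfl

/-- The `n`-dimensional Euclidean space `{x ∈ ℝ^(n+1) | x_0 + ⋯ + x_n = 0}`. -/
def sumZeroSpace (n : ℕ) : Submodule ℝ (EuclideanSpace ℝ (Fin (n + 1))) where
  carrier := {x | ∑ i, x i = 0}
  zero_mem' := by simp
  add_mem' := by
    intro a b ha hb
    simp only [Set.mem_setOf_eq] at ha hb ⊢
    simp [Finset.sum_add_distrib, ha, hb]
  smul_mem' := by
    intro c x hx
    simp only [Set.mem_setOf_eq] at hx ⊢
    simp [← Finset.mul_sum, hx]

/-- The root lattice `A_n = {x ∈ ℤ^(n+1) | x_0 + ⋯ + x_n = 0}`, as a lattice in the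
`n`-dimensional Euclidean space that it spans. -/
def rootLatticeA (n : ℕ) : Submodule ℤ (sumZeroSpace n) where
  carrier := {x | ∀ i, ∃ k : ℤ, (x : EuclideanSpace ℝ (Fin (n + 1))) i = k}
  zero_mem' := fun i => ⟨0, by simp⟩
  add_mem' := by
    intro a b ha hb i
    obtain ⟨k, hk⟩ := ha i
    obtain ⟨l, hl⟩ := hb i
    exact ⟨k + l, by simp [hk, hl]⟩
  smul_mem' := by
    intro c x hx i
    obtain ⟨k, hk⟩ := hx i
    refine ⟨c * k, ?_⟩
    rw [← Int.cast_smul_eq_zsmul ℝ c x]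
    simp [hk]

/-- Two subsets of Euclidean spaces are similar: a linear isometry followed by a scaling by a
positive factor maps the first one onto the second one. -/
def AreSimilar {E F : Type*} [NormedAddCommGroup E] [InnerProductSpace ℝ E]
    [NormedAddCommGroup F] [InnerProductSpace ℝ F] (S : Set E) (T : Set F) : Prop :=
  ∃ (f : E ≃ₗᵢ[ℝ] F) (c : ℝ), 0 < c ∧ (fun x => c • f x) '' S = T

/-!
Scaled suitably, non-orthogonal equiangular lines are supported by vectors `x i` of square length
`k > 1` with inner products `±1`. Their Gram matrix is `k + S` with `S` a Seidel matrix: symmetric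
and integral, with zero diagonal and off-diagonal entries `±1`.

*Upper bounds.* In dimension `n` the eigenvalue `-k` of `S` has multiplicity at least `card ι - n`.
With more than `2 n` lines this exceeds half the order, and as a minimal polynomial over `ℚ` is
separable, `k` is an integer (`exists_int_of_card_lt`). It is odd, since modulo `2` the matrix
`k + S` is the invertible `J - 1` if `k` and the order are even
(`IsEquiangularFamily.linearIndependent_of_even`). So `k = 3` or `k ≥ 5`, and the relative bound
`card ι * k ^ 2 ≤ n * (k ^ 2 + card ι - 1)` gives at most `6`, `10`, `16`, `28` lines for
`n = 3, 5, 6, 7`. In the plane the squares of the lines are independent in a space of dimension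
`3`. For `n = 4`, seven lines would give a Seidel matrix of order `7` with an eigenvalue of
multiplicity `3`, which must be an integer (`IsSeidel.rootMultiplicity_le_two`); evenness and the
relative bound then exclude it.

*Dimensions up to `13`.* With `28` lines the same argument forces `k = 3`. Three of the vectors
have, up to signs, inner products `-1` and form a regular tetrahedron together with the negative `q`
of their sum. Every other vector, with its sign chosen such that its inner product with `q` is `1`,
has inner product `1` with exactly one of the three, its pillar. Modulo the span of the tetrahedron
a pillar consists of orthogonal vectors and antipodes. A single nonempty pillar has at most
`2 (n - 3) ≤ 20` elements; if there are two, Bessel's inequality bounds each by `8`, so there are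
at most `4 + 24` lines, and if equality holds a pillar spans a space of dimension `4` that
contains the others (`card_eq_of_pillars`). Thus `28` lines span at most `7` dimensions.

*Lattices.* In the lattice generated by a basis of vectors of square length `3` with inner products
`±1`, square lengths are `0` or `3` modulo `4`, and the vectors of square length `3` have odd inner
products. They are therefore minimal, and equiangular as minimal vectors make angles of at least
`π / 3` (`IsEquiangularFamily.isEquiangular_minimalLines`). Sections of the lattice of integer
vectors reducing into the Hamming code attain the bounds for `n = 4, 5, 6, 7`; for `n = 2` the
hexagonal lattice does.

*Dimension three.* The diagonals of the icosahedron attain the bound `6`. If a lattice has at least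
four lines, and these are equiangular, an integer relation between four minimal vectors shows that
`k` is rational; being an algebraic integer it is an integer, and again `k = 3`. Three minimal
vectors with negative inner products and the negative of their sum are the vertices of a regular
tetrahedron, and by Parseval's identity for this frame there is no further minimal vector
(`isTetrahedral_of_four_le`). The minimal vectors of the dual of `A₃` form such a configuration too,
and all of these are similar.
-/

/-! ### Seidel matrices -/

/-- A family of vectors of square length `k`, any two of which have inner product `±1`. If `1 < k`,
they support equiangular lines of inverse cosine `k`. -/
structure IsEquiangularFamily {ι E : Type*} [NormedAddCommGroup E] [InnerProductSpace ℝ E]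
    (x : ι → E) (k : ℝ) : Prop where
  inner_self : ∀ i, ⟪x i, x i⟫ = k
  inner_ne : ∀ i j, i ≠ j → ⟪x i, x j⟫ = 1 ∨ ⟪x i, x j⟫ = -1

/-- A Seidel matrix: symmetric, with zero diagonal and all other entries `±1`. -/
structure IsSeidel {ι : Type*} (S : Matrix ι ι ℤ) : Prop where
  symm : ∀ i j, S i j = S j i
  diag : ∀ i, S i i = 0
  off : ∀ i j, i ≠ j → S i j = 1 ∨ S i j = -1

section
variable {ι E : Type*} [NormedAddCommGroup E] [InnerProductSpace ℝ E] {x : ι → E} {k : ℝ}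

theorem IsEquiangularFamily.exists_isSeidel [DecidableEq ι] (h : IsEquiangularFamily x k) :
    ∃ S : Matrix ι ι ℤ, IsSeidel S ∧ ∀ i j, ⟪x i, x j⟫ = (if i = j then k else 0) + S i j := by
  classical
  refine ⟨fun i j => if i = j then 0 else if ⟪x i, x j⟫ = 1 then 1 else -1, ⟨?_, ?_, ?_⟩, ?_⟩
  · intro i j
    simp only [eq_comm (a := i) (b := j), real_inner_comm (x i) (x j)]
  · simp
  · intro i j hij
    by_cases h1 : ⟪x i, x j⟫ = 1 <;> simp [hij, h1]
  · intro i j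
    by_cases hij : i = j
    · subst hij
      simpa using h.inner_self i
    · rcases h.inner_ne i j hij with h1 | h1 <;> norm_num [hij, h1]

theorem IsEquiangularFamily.comp {κ : Type*} (h : IsEquiangularFamily x k) (f : κ → ι)
    (hf : Function.Injective f) : IsEquiangularFamily (x ∘ f) k :=
  ⟨fun _ => h.inner_self _, fun _ _ hij => h.inner_ne _ _ (hf.ne hij)⟩

theorem inner_linearCombination [Fintype ι] (x : ι → E) (c : ι → ℝ) (y : E) :
    ⟪y, Fintype.linearCombination ℝ x c⟫ = ∑ j, c j * ⟪y, x j⟫ := by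
  simp [Fintype.linearCombination_apply, inner_sum, real_inner_smul_right]

/-- The eigenvalue `-k` of a Seidel matrix whose Gram matrix `k + S` comes from a space of
dimension `n` has multiplicity at least `card ι - n`. -/
theorem card_le_finrank_add_rootMultiplicity [Fintype ι] [DecidableEq ι] [FiniteDimensional ℝ E]
    {S : Matrix ι ι ℤ}
    (hS : ∀ i j, ⟪x i, x j⟫ = (if i = j then k else 0) + S i j) :
    Fintype.card ι ≤ Module.finrank ℝ E +
      (S.map (Int.cast : ℤ → ℝ)).charpoly.rootMultiplicity (-k) := by
  set T := Fintype.linearCombination ℝ x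
  set A := S.map (Int.cast : ℤ → ℝ)
  have hker : LinearMap.ker T ≤ Module.End.eigenspace A.toLin' (-k) := by
    intro c hc
    rw [LinearMap.mem_ker] at hc
    rw [Module.End.mem_eigenspace_iff]
    ext i
    have h0 : ⟪x i, T c⟫ = 0 := by rw [hc, inner_zero_right]
    rw [inner_linearCombination] at h0
    simp only [hS, mul_add, Finset.sum_add_distrib, mul_ite, mul_zero, Finset.sum_ite_eq,
      Finset.mem_univ, if_true] at h0
    simp only [Matrix.toLin'_apply, Matrix.mulVec, dotProduct, Pi.smul_apply, smul_eq_mul, A,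
      Matrix.map_apply]
    have : ∑ j, (S i j : ℝ) * c j = ∑ j, c j * S i j :=
      Finset.sum_congr rfl fun j _ => mul_comm _ _
    linarith
  have h1 := LinearMap.finrank_range_add_finrank_ker T
  have h2 := Submodule.finrank_mono hker
  have h3 := LinearMap.finrank_eigenspace_le A.toLin' (-k)
  have h4 := Submodule.finrank_le (LinearMap.range T)
  rw [Matrix.charpoly_toLin'] at h3
  simp only [Module.finrank_fintype_fun_eq_card] at h1
  omega

end

open Polynomial in
/-- As the minimal polynomial of an algebraic integer is separable, a root of multiplicity `m` of an
integer polynomial is a root of the `m`-th power of its minimal polynomial. -/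
theorem minpoly_pow_dvd {a : ℝ} (ha : IsIntegral ℤ a) (m : ℕ) :
    ∀ f : ℤ[X], f ≠ 0 → m ≤ (f.map (Int.castRingHom ℝ)).rootMultiplicity a →
      minpoly ℤ a ^ m ∣ f := by
  have hp : ((minpoly ℤ a).map (Int.castRingHom ℝ)).rootMultiplicity a ≤ 1 := by
    apply rootMultiplicity_le_one_of_separable
    have h1 : (minpoly ℚ a).Separable := (minpoly.irreducible (ha.tower_top)).separable
    rw [minpoly.isIntegrallyClosed_eq_field_fractions' ℚ ha] at h1
    have h2 := h1.map (f := algebraMap ℚ ℝ)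
    rwa [Polynomial.map_map, RingHom.ext_int ((algebraMap ℚ ℝ).comp (algebraMap ℤ ℚ))
      (Int.castRingHom ℝ)] at h2
  induction m with
  | zero => simp
  | succ m ih =>
    intro f hf hm
    have hf' : f.map (Int.castRingHom ℝ) ≠ 0 :=
      (Polynomial.map_ne_zero_iff (RingHom.injective_int _)).2 hf
    have hroot : aeval a f = 0 := by
      have : (f.map (Int.castRingHom ℝ)).IsRoot a :=
        (rootMultiplicity_pos hf').1 (by omega)
      rwa [IsRoot.def, eval_map, ← algebraMap_int_eq, ← aeval_def] at this
    obtain ⟨g, rfl⟩ := minpoly.isIntegrallyClosed_dvd ha hroot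
    have hg : g ≠ 0 := right_ne_zero_of_mul hf
    rw [Polynomial.map_mul] at hm hf'
    rw [rootMultiplicity_mul hf'] at hm
    rw [pow_succ']
    exact mul_dvd_mul_left _ (ih g hg (by omega))

section
variable {ι : Type*} [Fintype ι] [DecidableEq ι] {S : Matrix ι ι ℤ}

open Polynomial in
theorem charpoly_map_int (S : Matrix ι ι ℤ) :
    (S.map (Int.cast : ℤ → ℝ)).charpoly = S.charpoly.map (Int.castRingHom ℝ) :=
  Matrix.charpoly_map S (Int.castRingHom ℝ)

open Polynomial in
theorem isIntegral_of_rootMultiplicity_pos {a : ℝ}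
    (h : 0 < (S.map (Int.cast : ℤ → ℝ)).charpoly.rootMultiplicity a) : IsIntegral ℤ a := by
  refine ⟨S.charpoly, Matrix.charpoly_monic S, ?_⟩
  have h1 := (rootMultiplicity_pos (Matrix.charpoly_monic _).ne_zero).1 h
  rwa [charpoly_map_int, IsRoot.def, eval_map, ← algebraMap_int_eq] at h1

open Polynomial in
/-- A root of multiplicity more than half the degree is an integer. -/
theorem exists_int_of_card_lt {a : ℝ}
    (h : Fintype.card ι < 2 * (S.map (Int.cast : ℤ → ℝ)).charpoly.rootMultiplicity a) :
    ∃ m : ℤ, a = m := by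
  set m := (S.map (Int.cast : ℤ → ℝ)).charpoly.rootMultiplicity a with hm
  have ha : IsIntegral ℤ a := isIntegral_of_rootMultiplicity_pos (S := S) (by omega)
  have hdvd := minpoly_pow_dvd ha m S.charpoly (Matrix.charpoly_monic S).ne_zero
    (by rw [hm, charpoly_map_int])
  have hdeg := natDegree_le_of_dvd hdvd (Matrix.charpoly_monic S).ne_zero
  rw [natDegree_pow, Matrix.charpoly_natDegree_eq_dim] at hdeg
  have hpos := minpoly.natDegree_pos ha
  have h1 : (minpoly ℤ a).natDegree = 1 := by
    by_contra hne
    have : 2 ≤ (minpoly ℤ a).natDegree := by omega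
    nlinarith
  have := (minpoly.natDegree_eq_one_iff).1 h1
  obtain ⟨b, hb⟩ := this
  exact ⟨b, by simpa using hb.symm⟩

end

theorem IsSeidel.cast_zmod_two {ι : Type*} [DecidableEq ι] {S : Matrix ι ι ℤ}
    (hS : IsSeidel S) (i j : ι) :
    (S i j : ZMod 2) = if i = j then 0 else 1 := by
  by_cases hij : i = j
  · subst hij; simp [hS.diag]
  · rcases hS.off i j hij with h | h
    · simp [h, hij]
    · simp [h, hij]

section
variable {ι : Type*} [Fintype ι] [DecidableEq ι] {S : Matrix ι ι ℤ}

/-- The determinant is odd: modulo `2` the matrix is `J - 1`, where `J` is the all-ones matrix, and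
`(J - 1) ^ 2 = 1` in even order. -/
theorem IsSeidel.det_add_even_ne_zero (hS : IsSeidel S) (hι : Even (Fintype.card ι)) {m : ℤ}
    (hm : Even m) : (Matrix.diagonal (fun _ => m) + S).det ≠ 0 := by
  intro h0
  have hm2 : (m : ZMod 2) = 0 := (ZMod.intCast_zmod_eq_zero_iff_dvd m 2).2 hm.two_dvd
  have hc : (Fintype.card ι : ZMod 2) = 0 := (ZMod.natCast_eq_zero_iff _ 2).2 hι.two_dvd
  have h1 := RingHom.map_det (Int.castRingHom (ZMod 2)) (Matrix.diagonal (fun _ => m) + S)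
  set J : Matrix ι ι (ZMod 2) := Matrix.of fun _ _ => 1 with hJ
  have hB : (Int.castRingHom (ZMod 2)).mapMatrix (Matrix.diagonal (fun _ => m) + S) = J - 1 := by
    ext i j
    by_cases hij : i = j
    · subst hij
      simp [hm2, hS.cast_zmod_two, J]
    · simp [hS.cast_zmod_two, J, hij]
  have hJJ : J * J = 0 := by
    ext i j
    simp [J, Matrix.mul_apply, hc]
  have h2 : (2 : ZMod 2) = 0 := by decide
  have hBB : (J - 1) * (J - 1) = 1 := by
    have : (J - 1) * (J - 1) = J * J - (2 : ZMod 2) • J + 1 := by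
      rw [two_smul]; noncomm_ring
    rw [this, hJJ, h2]; simp
  rw [h0, hB, map_zero] at h1
  have h3 := congrArg Matrix.det hBB
  rw [Matrix.det_mul, ← h1] at h3
  simp at h3

/-- In odd order the rows of a Seidel matrix have even sums. -/
theorem IsSeidel.even_det (hS : IsSeidel S) (hι : Odd (Fintype.card ι)) : Even S.det := by
  have h1 := RingHom.map_det (Int.castRingHom (ZMod 2)) S
  have : Nonempty ι := Fintype.card_pos_iff.1 hι.pos
  have h2 : ((Int.castRingHom (ZMod 2)).mapMatrix S).det = 0 := by
    refine Matrix.exists_mulVec_eq_zero_iff.1 ⟨fun _ => 1, ?_, ?_⟩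
    · intro h
      simpa using congrFun h (Classical.arbitrary ι)
    · ext i
      obtain ⟨r, hr⟩ := hι
      have hsub : Fintype.card ι - 1 = 2 * r := by omega
      simp only [RingHom.mapMatrix_apply, Matrix.mulVec, dotProduct, Matrix.map_apply,
        Int.coe_castRingHom, hS.cast_zmod_two, mul_one, Finset.sum_ite, Finset.sum_const_zero,
        Finset.sum_const, Finset.filter_ne, Finset.card_erase_of_mem (Finset.mem_univ i),
        Finset.card_univ, hsub, Pi.zero_apply, zero_add, nsmul_eq_mul]
      push_cast
      rw [show (2 : ZMod 2) = 0 by decide, zero_mul]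
  rw [h2] at h1
  exact even_iff_two_dvd.2 ((ZMod.intCast_zmod_eq_zero_iff_dvd S.det 2).1 h1)

theorem sum_eq_two_mul_sum_lt {ι : Type*} [Fintype ι] [LinearOrder ι] (f : ι → ι → ℤ)
    (hf : ∀ i j, f i j = f j i) (h0 : ∀ i, f i i = 0) :
    ∑ i, ∑ j, f i j = 2 * ∑ p : ι × ι with p.1 < p.2, f p.1 p.2 := by
  rw [← Fintype.sum_prod_type' f,
    ← Finset.sum_filter_add_sum_filter_not Finset.univ (fun p : ι × ι => p.1 < p.2), two_mul]
  congr 1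
  rw [← Finset.sum_filter_add_sum_filter_not _ (fun p : ι × ι => p.1 = p.2),
    Finset.sum_eq_zero, zero_add]
  · refine Finset.sum_nbij' Prod.swap Prod.swap ?_ ?_ ?_ ?_ ?_
    · rintro ⟨i, j⟩ h
      simp only [Finset.mem_filter, Finset.mem_univ, true_and, Prod.swap] at h ⊢
      exact lt_of_le_of_ne (not_lt.1 h.1) (Ne.symm h.2)
    · rintro ⟨i, j⟩ h
      simp only [Finset.mem_filter, Finset.mem_univ, true_and, Prod.swap] at h ⊢
      exact ⟨h.le.not_gt, h.ne'⟩
    · simp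
    · simp
    · rintro ⟨i, j⟩ _
      exact hf i j
  · rintro ⟨i, j⟩ h
    simp only [Finset.mem_filter, Finset.mem_univ, true_and] at h
    obtain ⟨-, rfl⟩ := h
    exact h0 i

/-- A primitive integer vector in the kernel of a Seidel matrix of odd order has odd coordinates
only, so that `vᵀSv` is twice a sum of `21` odd numbers when the order is `7`. -/
theorem IsSeidel.det_ne_zero_of_order_seven {S : Matrix (Fin 7) (Fin 7) ℤ} (hS : IsSeidel S) :
    S.det ≠ 0 := by
  intro h0
  obtain ⟨u, hu0, hu⟩ := Matrix.exists_mulVec_eq_zero_iff.2 h0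
  obtain ⟨v, huv, hv⟩ := Finset.extract_gcd u (Finset.univ_nonempty (α := Fin 7))
  set g := Finset.univ.gcd u
  have hg : g ≠ 0 := by
    intro hg
    exact hu0 (funext fun i => by rw [huv i (Finset.mem_univ _), hg]; simp)
  have hSv : S.mulVec v = 0 := by
    have : u = g • v := funext fun i => by simpa using huv i (Finset.mem_univ _)
    rw [this, Matrix.mulVec_smul] at hu
    exact (smul_eq_zero.1 hu).resolve_left hg
  have hrow (i) : ∑ j, S i j * v j = 0 := congrFun hSv i
  have hpar (i) : (v i : ZMod 2) = ∑ j, (v j : ZMod 2) := by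
    have h1 := congrArg (Int.cast : ℤ → ZMod 2) (hrow i)
    push_cast at h1
    simp only [hS.cast_zmod_two] at h1
    have h2 : ∑ j, (v j : ZMod 2) =
        ∑ j, ((if i = j then 0 else 1) * (v j : ZMod 2) + if i = j then (v j : ZMod 2) else 0) :=
      Finset.sum_congr rfl fun j _ => by split_ifs <;> simp
    rw [Finset.sum_add_distrib, h1] at h2
    simpa using h2.symm
  have hodd (i) : Odd (v i) := by
    by_contra hne
    rw [Int.not_odd_iff_even, even_iff_two_dvd] at hne
    have hi : (v i : ZMod 2) = 0 := (ZMod.intCast_zmod_eq_zero_iff_dvd _ 2).2 hne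
    have hall : ∀ j ∈ Finset.univ, (2 : ℤ) ∣ v j := fun j _ =>
      (ZMod.intCast_zmod_eq_zero_iff_dvd _ 2).1 (by rw [hpar j, ← hpar i, hi])
    have := Finset.dvd_gcd hall
    rw [hv] at this
    omega
  have hsum : ∑ i, ∑ j, v i * S i j * v j = 0 := by
    refine Finset.sum_eq_zero fun i _ => ?_
    have := hrow i
    simp only [mul_assoc, ← Finset.mul_sum, this, mul_zero]
  rw [sum_eq_two_mul_sum_lt _ (fun i j => by rw [hS.symm i j]; ring) (by simp [hS.diag])] at hsum
  have hzero : ∑ p : Fin 7 × Fin 7 with p.1 < p.2, v p.1 * S p.1 p.2 * v p.2 = 0 := by omega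
  have hcast := congrArg (Int.cast : ℤ → ZMod 2) hzero
  have hv1 (i) : (v i : ZMod 2) = 1 := by
    obtain ⟨r, hr⟩ := hodd i
    rw [hr]
    push_cast
    rw [show (2 : ZMod 2) = 0 by decide, zero_mul, zero_add]
  push_cast at hcast
  rw [Finset.sum_congr rfl (g := fun _ => (1 : ZMod 2))] at hcast
  · revert hcast
    decide
  · intro p hp
    have hp' : p.1 ≠ p.2 := ((Finset.mem_filter.1 hp).2 : p.1 < p.2).ne
    rw [hv1, hv1, hS.cast_zmod_two, if_neg hp', mul_one, mul_one]

end

/-! ### The relative bound and integrality -/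

section
variable {ι E : Type*} [NormedAddCommGroup E] [InnerProductSpace ℝ E] {x : ι → E} {k : ℝ}

/-- The squared trace of the frame operator `∑ i, x i ⊗ x i` is at most `dim E` times the trace of
its square. -/
theorem sq_sum_inner_self_le [Fintype ι] [FiniteDimensional ℝ E] (x : ι → E) :
    (∑ i, ⟪x i, x i⟫) ^ 2 ≤ Module.finrank ℝ E * ∑ i, ∑ j, ⟪x i, x j⟫ ^ 2 := by
  set b := stdOrthonormalBasis ℝ E
  have hin (i j) : ⟪x i, x j⟫ = ∑ a, ⟪b a, x i⟫ * ⟪b a, x j⟫ := by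
    rw [← b.sum_inner_mul_inner]
    exact Finset.sum_congr rfl fun a _ => by rw [real_inner_comm]
  have h1 : ∑ i, ⟪x i, x i⟫ = ∑ a, ∑ i, ⟪b a, x i⟫ * ⟪b a, x i⟫ := by
    simp only [hin]
    exact Finset.sum_comm
  have h2 : ∑ i, ∑ j, ⟪x i, x j⟫ ^ 2 = ∑ a, ∑ c, (∑ i, ⟪b a, x i⟫ * ⟪b c, x i⟫) ^ 2 := by
    simp only [hin, sq, Finset.sum_mul_sum]
    have e1 (i) : ∑ j, ∑ a, ∑ c, ⟪b a, x i⟫ * ⟪b a, x j⟫ * (⟪b c, x i⟫ * ⟪b c, x j⟫)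
        = ∑ a, ∑ c, ∑ j, ⟪b a, x i⟫ * ⟪b c, x i⟫ * (⟪b a, x j⟫ * ⟪b c, x j⟫) := by
      rw [Finset.sum_comm]
      refine Finset.sum_congr rfl fun a _ => ?_
      rw [Finset.sum_comm]
      exact Finset.sum_congr rfl fun c _ => Finset.sum_congr rfl fun j _ => by ring
    simp only [e1]
    rw [Finset.sum_comm]
    exact Finset.sum_congr rfl fun a _ => Finset.sum_comm
  rw [h1, h2]
  calc (∑ a, ∑ i, ⟪b a, x i⟫ * ⟪b a, x i⟫) ^ 2
      ≤ Module.finrank ℝ E * ∑ a, (∑ i, ⟪b a, x i⟫ * ⟪b a, x i⟫) ^ 2 := by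
        simpa using sq_sum_le_card_mul_sum_sq (s := Finset.univ)
          (f := fun a => ∑ i, ⟪b a, x i⟫ * ⟪b a, x i⟫)
    _ ≤ _ := by
        gcongr with a _
        exact Finset.single_le_sum (f := fun c => (∑ i, ⟪b a, x i⟫ * ⟪b c, x i⟫) ^ 2)
          (fun c _ => sq_nonneg _) (Finset.mem_univ a)

/-- The relative bound: `sq_sum_inner_self_le` applied to equiangular vectors. -/
theorem IsEquiangularFamily.relative_bound [Fintype ι] [FiniteDimensional ℝ E]
    (h : IsEquiangularFamily x k) (hk : 1 < k) :
    Fintype.card ι * k ^ 2 ≤ Module.finrank ℝ E * (k ^ 2 + Fintype.card ι - 1) := by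
  classical
  have h1 := sq_sum_inner_self_le x
  have hsq (i j) : ⟪x i, x j⟫ ^ 2 = 1 + if i = j then k ^ 2 - 1 else 0 := by
    by_cases hij : i = j
    · subst hij
      rw [h.inner_self]; simp
    · rcases h.inner_ne i j hij with e | e <;> simp [e, hij]
  simp only [h.inner_self, hsq, Finset.sum_add_distrib, Finset.sum_ite_eq, Finset.mem_univ,
    if_true, Finset.sum_const, Finset.card_univ, nsmul_eq_mul, mul_one] at h1
  rcases Nat.eq_zero_or_pos (Fintype.card ι) with h0 | h0
  · rw [h0, Nat.cast_zero, zero_mul]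
    have : 0 ≤ k ^ 2 + 0 - 1 := by nlinarith
    positivity
  · have h0' : (0 : ℝ) < Fintype.card ι := by exact_mod_cast h0
    refine le_of_mul_le_mul_left ?_ h0'
    nlinarith

theorem card_le_finrank_of_orthogonal [Fintype ι] [FiniteDimensional ℝ E]
    (h0 : ∀ i, x i ≠ 0) (h : ∀ i j, i ≠ j → ⟪x i, x j⟫ = 0) :
    Fintype.card ι ≤ Module.finrank ℝ E :=
  (linearIndependent_of_ne_zero_of_inner_eq_zero h0 h).fintype_card_le_finrank

theorem linearIndependent_of_inner_eq {a b : ℝ} (hb : 0 ≤ b) (hab : b < a)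
    (h0 : ∀ i, ⟪x i, x i⟫ = a) (h : ∀ i j, i ≠ j → ⟪x i, x j⟫ = b) :
    LinearIndependent ℝ x := by
  classical
  rw [linearIndependent_iff']
  intro s c hc i hi
  have h1 : ∀ i ∈ s, (a - b) * c i + b * ∑ j ∈ s, c j = 0 := by
    intro i hi
    have h2 : ⟪x i, ∑ j ∈ s, c j • x j⟫ = 0 := by rw [hc, inner_zero_right]
    rw [inner_sum] at h2
    have h3 : ∀ j, ⟪x i, c j • x j⟫ = b * c j + if i = j then (a - b) * c j else 0 := by
      intro j
      rw [real_inner_smul_right]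
      by_cases hij : i = j
      · subst hij
        rw [h0]; simp; ring
      · simp [h i j hij, hij]; ring
    simp only [h3, Finset.sum_add_distrib, Finset.sum_ite_eq, hi, if_true, ← Finset.mul_sum] at h2
    linarith
  have hab' : 0 < a - b := by linarith
  have hsum : ∑ j ∈ s, c j = 0 := by
    have h2 := Finset.sum_eq_zero h1
    rw [Finset.sum_add_distrib, ← Finset.mul_sum, Finset.sum_const, nsmul_eq_mul, ← mul_assoc,
      mul_comm _ b, mul_assoc, ← mul_assoc, ← add_mul] at h2
    refine (mul_eq_zero.1 h2).resolve_left ?_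
    positivity
  have := h1 i hi
  rw [hsum, mul_zero, add_zero] at this
  exact (mul_eq_zero.1 this).resolve_left hab'.ne'

/-- Modulo `2` the Gram matrix is `J - 1`, which is invertible in even order. -/
theorem IsEquiangularFamily.linearIndependent_of_even [Fintype ι] {m : ℤ}
    (h : IsEquiangularFamily x m) (hm : Even m) (hι : Even (Fintype.card ι)) :
    LinearIndependent ℝ x := by
  classical
  obtain ⟨S, hS, hG⟩ := h.exists_isSeidel
  rw [← Matrix.det_gram_ne_zero_iff_linearIndependent]
  have h1 : Matrix.gram ℝ x =
      (Int.castRingHom ℝ).mapMatrix (Matrix.diagonal (fun _ => m) + S) := by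
    ext i j
    rw [Matrix.gram_apply, hG]
    by_cases hij : i = j <;> simp [hij]
  rw [h1, ← RingHom.map_det]
  simpa using hS.det_add_even_ne_zero hι hm

/-- Equiangular vectors of even square length that are odd in number become independent after
removing one. -/
theorem IsEquiangularFamily.card_le_finrank_add_one [Fintype ι] [FiniteDimensional ℝ E] {m : ℤ}
    (h : IsEquiangularFamily x m) (hm : Even m) :
    Fintype.card ι ≤ Module.finrank ℝ E + 1 := by
  rcases Nat.even_or_odd' (Fintype.card ι) with ⟨r, hr | hr⟩
  · have := (h.linearIndependent_of_even hm ⟨r, by omega⟩).fintype_card_le_finrank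
    omega
  · set e : Fin (2 * r) → ι := fun i => (Fintype.equivFin ι).symm (Fin.castLE (by omega) i)
    have he : Function.Injective e :=
      (Fintype.equivFin ι).symm.injective.comp (Fin.castLE_injective _)
    have := ((h.comp e he).linearIndependent_of_even hm (by simp)).fintype_card_le_finrank
    simp at this
    omega

/-- With more than `2 * dim E` lines the inverse cosine `k` is an odd integer greater than `1`. -/
theorem IsEquiangularFamily.three_le_and_of_two_mul_finrank_lt [Fintype ι] [FiniteDimensional ℝ E]
    (h : IsEquiangularFamily x k) (hk : 1 < k)
    (hn : 2 * Module.finrank ℝ E < Fintype.card ι) (hpos : 0 < Module.finrank ℝ E) :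
    3 ≤ k ∧ (k = 3 ∨ 5 ≤ k) := by
  classical
  obtain ⟨S, hS, hG⟩ := h.exists_isSeidel
  have hmult := card_le_finrank_add_rootMultiplicity hG
  obtain ⟨m, hm⟩ := exists_int_of_card_lt (S := S) (a := -k) (by omega)
  obtain ⟨l, rfl⟩ : ∃ l : ℤ, k = l := ⟨-m, by push_cast; linarith⟩
  have hodd : Odd l := by
    rw [← Int.not_even_iff_odd]
    intro he
    have := h.card_le_finrank_add_one he
    omega
  obtain ⟨r, hr⟩ := hodd
  have h1 : (1 : ℤ) < l := by exact_mod_cast hk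
  have h2 : 3 ≤ l ∧ (l = 3 ∨ 5 ≤ l) := by omega
  exact_mod_cast h2

end

theorem sum_sq_eigenvalues {ι : Type*} [Fintype ι] [DecidableEq ι] {A : Matrix ι ι ℝ}
    (hA : A.IsHermitian) : ∑ i, hA.eigenvalues i ^ 2 = (A * A).trace := by
  conv_rhs => rw [hA.spectral_theorem, ← map_mul, Unitary.conjStarAlgAut_apply,
    Matrix.trace_mul_cycle, Unitary.coe_star_mul_self, one_mul, Matrix.diagonal_mul_diagonal,
    Matrix.trace_diagonal]
  simp [sq]

theorem IsSeidel.trace_mul_self {ι : Type*} [Fintype ι] [DecidableEq ι] {S : Matrix ι ι ℤ}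
    (hS : IsSeidel S) :
    (S.map (Int.cast : ℤ → ℝ) * S.map (Int.cast : ℤ → ℝ)).trace =
      Fintype.card ι * (Fintype.card ι - 1) := by
  have h (i j) : (S i j : ℝ) * S j i = 1 - if i = j then 1 else 0 := by
    by_cases hij : i = j
    · subst hij; simp [hS.diag]
    · rw [hS.symm j i]
      rcases hS.off i j hij with e | e <;> simp [e, hij]
  simp [Matrix.trace, Matrix.mul_apply, h, mul_sub]

open Polynomial in
/-- If an irrational eigenvalue of a Seidel matrix of order `7` had multiplicity `3`, the
characteristic polynomial would be `p³ (X - μ)` with `p` quadratic. The traces of `S` and `S²` leave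
few candidates for `p`, which the parity of the determinant and its nonvanishing exclude. -/
theorem IsSeidel.rootMultiplicity_le_two {S : Matrix (Fin 7) (Fin 7) ℤ} (hS : IsSeidel S) {a : ℝ}
    (ha : ∀ m : ℤ, a ≠ m) :
    (S.map (Int.cast : ℤ → ℝ)).charpoly.rootMultiplicity a ≤ 2 := by
  by_contra! hm
  set A := S.map (Int.cast : ℤ → ℝ) with hAdef
  have hA : A.IsHermitian := by
    ext i j
    simp [A, hS.symm i j]
  have hint : IsIntegral ℤ a := isIntegral_of_rootMultiplicity_pos (S := S) (by rw [← hAdef]; omega)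
  have hmonic := Matrix.charpoly_monic S
  have hpm := minpoly.monic hint
  obtain ⟨g, hg⟩ := minpoly_pow_dvd hint 3 S.charpoly hmonic.ne_zero
    (by rw [← charpoly_map_int]; exact hm)
  set p := minpoly ℤ a with hp
  have hgm : g.Monic := (hpm.pow 3).of_mul_monic_left (hg ▸ hmonic)
  have hdeg := congrArg natDegree hg
  rw [(hpm.pow 3).natDegree_mul hgm, hpm.natDegree_pow, Matrix.charpoly_natDegree_eq_dim,
    Fintype.card_fin] at hdeg
  have hpos := minpoly.natDegree_pos hint
  have hne1 : p.natDegree ≠ 1 := by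
    intro h1
    obtain ⟨b, hb⟩ := minpoly.natDegree_eq_one_iff.1 h1
    exact ha b (by simpa using hb.symm)
  have hp2 : p.natDegree = 2 := by rw [← hp] at hpos; omega
  have hg1 : g = X + C (g.coeff 0) := hgm.eq_X_add_C (by omega)
  set c := g.coeff 0
  -- the two roots of the minimal polynomial are real
  set P := p.map (Int.castRingHom ℝ) with hP
  have hPm : P.Monic := hpm.map _
  have hf : A.charpoly = P ^ 3 * (X + C (c : ℝ)) := by
    rw [hAdef, charpoly_map_int, hg, hg1]
    simp [P]
  have hPsplit : P.Splits :=
    hA.splits_charpoly.of_dvd (Matrix.charpoly_monic A).ne_zero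
      (hf ▸ (dvd_pow_self P (by norm_num)).mul_right _)
  have hcard : P.roots.card = 2 := by
    rw [splits_iff_card_roots.1 hPsplit, hP, hpm.natDegree_map, hp2]
  obtain ⟨r, s, hrs⟩ := Multiset.card_eq_two.1 hcard
  have hPeq : P = X ^ 2 - C (r + s) * X + C (r * s) := by
    rw [hPsplit.eq_prod_roots_of_monic hPm, hrs]
    simp only [Multiset.insert_eq_cons, Multiset.map_cons, Multiset.map_singleton,
      Multiset.prod_cons, Multiset.prod_singleton, C_add, C_mul]
    ring
  have hc0 : (p.coeff 0 : ℝ) = r * s := by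
    have : P.coeff 0 = r * s := by rw [hPeq]; simp
    simpa [P] using this
  have hc1 : (p.coeff 1 : ℝ) = -(r + s) := by
    have : P.coeff 1 = -(r + s) := by rw [hPeq]; simp [coeff_C]
    simpa [P] using this
  have hroots : A.charpoly.roots = 3 • ({r, s} : Multiset ℝ) + {-(c : ℝ)} := by
    rw [hf, roots_mul (hf ▸ (Matrix.charpoly_monic A).ne_zero), roots_pow, hrs,
      show X + C (c : ℝ) = X - C (-(c : ℝ)) by simp, roots_X_sub_C]
  have hsum (φ : ℝ → ℝ) : ∑ i, φ (hA.eigenvalues i) = 3 * (φ r + φ s) + φ (-c) := by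
    have h1 := hA.roots_charpoly_eq_eigenvalues
    rw [hroots] at h1
    have h2 := congrArg (fun M : Multiset ℝ => (M.map φ).sum) h1
    simp only [Multiset.map_map] at h2
    rw [Multiset.map_add, Multiset.map_nsmul, Multiset.sum_add, Multiset.sum_nsmul] at h2
    simp only [Multiset.insert_eq_cons, Multiset.map_cons, Multiset.map_singleton,
      Multiset.sum_cons, Multiset.sum_singleton, nsmul_eq_mul] at h2
    rw [Finset.sum_eq_multiset_sum]
    push_cast at h2
    rw [h2]
    rfl
  have htr1 : 3 * (r + s) + -(c : ℝ) = 0 := by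
    have h1 := hA.trace_eq_sum_eigenvalues
    have h2 := hsum id
    simp only [id] at h2
    rw [← h2]
    simpa [Matrix.trace, A, hS.diag] using h1.symm
  have htr2 : 3 * (r ^ 2 + s ^ 2) + (-(c : ℝ)) ^ 2 = 42 := by
    have h1 := sum_sq_eigenvalues hA
    rw [hS.trace_mul_self, hsum (fun x => x ^ 2)] at h1
    rw [h1]; norm_num
  have hcb : c = -3 * p.coeff 1 := by
    have : (c : ℝ) = -3 * p.coeff 1 := by rw [hc1]; linarith
    exact_mod_cast this
  have hdb : p.coeff 0 = 2 * p.coeff 1 ^ 2 - 7 := by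
    have : (p.coeff 0 : ℝ) = 2 * p.coeff 1 ^ 2 - 7 := by
      rw [hc0, hc1]
      have : (c : ℝ) = 3 * (r + s) := by linarith
      rw [this] at htr2
      linarith
    exact_mod_cast this
  have hdisc : (r - s) ^ 2 = 28 - 7 * (p.coeff 1 : ℝ) ^ 2 := by
    have : (p.coeff 0 : ℝ) = 2 * p.coeff 1 ^ 2 - 7 := by exact_mod_cast hdb
    rw [hc0, hc1] at this
    rw [hc1]
    linarith
  have hb4 : p.coeff 1 ^ 2 ≤ 4 := by
    have h1 := sq_nonneg (r - s)
    have : (p.coeff 1 : ℝ) ^ 2 ≤ 4 := by rw [hdisc] at h1; linarith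
    exact_mod_cast this
  have hdet : S.det = -(p.coeff 0 ^ 3 * c) := by
    have h1 : S.charpoly.coeff 0 = p.coeff 0 ^ 3 * g.coeff 0 := by
      simp only [coeff_zero_eq_eval_zero, hg, eval_mul, eval_pow]
    rw [Matrix.det_eq_sign_charpoly_coeff, h1, Fintype.card_fin]
    ring
  have heven := hS.even_det (by decide)
  have hne := hS.det_ne_zero_of_order_seven
  have haP : (a - r) * (a - s) = 0 := by
    have h1 : aeval a p = 0 := minpoly.aeval ℤ a
    have h2 : P.eval a = 0 := by
      rw [hP, eval_map, ← algebraMap_int_eq]; exact h1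
    rw [hPeq] at h2
    simp only [eval_add, eval_sub, eval_mul, eval_pow, eval_X, eval_C] at h2
    linarith
  clear_value c
  generalize p.coeff 1 = b at *
  generalize p.coeff 0 = d at *
  obtain ⟨hb1, hb2⟩ : -2 ≤ b ∧ b ≤ 2 := by
    clear * - hb4
    constructor <;> nlinarith
  have hrs' : b ^ 2 = 4 → ∃ m : ℤ, a = m := by
    intro h4
    have h4' : (b : ℝ) ^ 2 = 4 := by exact_mod_cast h4
    have h5 : r = s := by
      rw [h4'] at hdisc
      exact sub_eq_zero.1 (pow_eq_zero_iff (two_ne_zero)|>.1 (by linarith))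
    subst h5
    have h6 : a = r := by
      rcases mul_eq_zero.1 haP with h | h <;> linarith
    have h7 : b = 2 ∨ b = -2 := sq_eq_sq_iff_eq_or_eq_neg.1 (by linarith)
    rcases h7 with rfl | rfl
    · exact ⟨-1, by push_cast at *; linarith⟩
    · exact ⟨1, by push_cast at *; linarith⟩
  rw [hcb, hdb] at hdet
  obtain rfl | rfl | rfl | rfl | rfl : b = -2 ∨ b = -1 ∨ b = 0 ∨ b = 1 ∨ b = 2 := by omega
  · obtain ⟨m, hm⟩ := hrs' (by norm_num)
    exact ha m hm
  · rw [hdet] at heven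
    exact absurd heven (by decide)
  · exact hne (by rw [hdet]; norm_num)
  · rw [hdet] at heven
    exact absurd heven (by decide)
  · obtain ⟨m, hm⟩ := hrs' (by norm_num)
    exact ha m hm

/-! ### Equiangular lines in dimension at most seven -/

section
variable {ι E : Type*} [NormedAddCommGroup E] [InnerProductSpace ℝ E] {x : ι → E} {k : ℝ}

theorem IsEquiangularFamily.smul_sign (h : IsEquiangularFamily x k) {ε : ι → ℝ}
    (hε : ∀ i, ε i = 1 ∨ ε i = -1) : IsEquiangularFamily (fun i => ε i • x i) k := by
  constructor
  · intro i
    rw [real_inner_smul_left, real_inner_smul_right, h.inner_self]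
    rcases hε i with e | e <;> rw [e] <;> ring
  · intro i j hij
    simp only [real_inner_smul_left, real_inner_smul_right]
    rcases hε i with e | e <;> rcases hε j with f | f <;> rcases h.inner_ne i j hij with g | g <;>
      rw [e, f, g] <;> norm_num

/-- Dependent equiangular vectors contain, up to signs, three vectors with negative inner products:
otherwise signs can be chosen such that all inner products are positive. -/
theorem IsEquiangularFamily.exists_triple (h : IsEquiangularFamily x k) (hk : 1 < k)
    (hdep : ¬ LinearIndependent ℝ x) :
    ∃ (f : Fin 3 → ι) (ε : Fin 3 → ℝ), Function.Injective f ∧ (∀ a, ε a = 1 ∨ ε a = -1) ∧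
      ∀ a b, a ≠ b → ⟪ε a • x (f a), ε b • x (f b)⟫ = -1 := by
  classical
  have hne : Nonempty ι := by
    by_contra hne
    rw [not_nonempty_iff] at hne
    exact hdep linearIndependent_empty_type
  obtain ⟨o⟩ := hne
  set δ : ι → ℝ := fun i => if i = o then 1 else ⟪x o, x i⟫ with hδ
  have hδ1 : ∀ i, δ i = 1 ∨ δ i = -1 := by
    intro i
    by_cases hi : i = o
    · simp [hδ, hi]
    · simpa [hδ, hi] using h.inner_ne o i (Ne.symm hi)
  have ho : ∀ i, i ≠ o → ⟪δ o • x o, δ i • x i⟫ = 1 := by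
    intro i hi
    have h1 : δ o = 1 := by simp [hδ]
    have h2 : δ i = ⟪x o, x i⟫ := by simp [hδ, hi]
    rw [h1, one_smul, real_inner_smul_right, h2]
    rcases h.inner_ne o i (Ne.symm hi) with e | e <;> rw [e] <;> norm_num
  have hx' := h.smul_sign hδ1
  obtain ⟨i, j, hij, hneg⟩ : ∃ i j, i ≠ j ∧ ⟪δ i • x i, δ j • x j⟫ = -1 := by
    by_contra! hall
    have hli := linearIndependent_of_inner_eq zero_le_one hk hx'.inner_self
      (fun i j hij => (hx'.inner_ne i j hij).resolve_right (hall i j hij))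
    refine hdep ?_
    have := hli.units_smul (fun i => Units.mk0 (δ i) (by
      rcases hδ1 i with e | e <;> rw [e] <;> norm_num))
    convert this using 1
    ext i
    simp only [Pi.smul_apply', Units.smul_mk0, smul_smul]
    rcases hδ1 i with e | e <;> rw [e] <;> norm_num
  have hio : i ≠ o := by
    rintro rfl
    rw [ho j hij.symm] at hneg
    norm_num at hneg
  have hjo : j ≠ o := by
    rintro rfl
    rw [real_inner_comm, ho i hij] at hneg
    norm_num at hneg
  have e1 := ho i hio
  have e2 := ho j hjo
  have e1' := real_inner_comm (δ o • x o) (δ i • x i)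
  have e2' := real_inner_comm (δ o • x o) (δ j • x j)
  have hneg' := real_inner_comm (δ i • x i) (δ j • x j)
  refine ⟨![o, i, j], ![-δ o, δ i, δ j], ?_, ?_, ?_⟩
  · intro a b
    fin_cases a <;> fin_cases b <;> simp [hio, hjo, hij, hio.symm, hjo.symm, hij.symm]
  · intro a
    have h3 : -δ o = 1 ∨ -δ o = -1 := by rcases hδ1 o with e | e <;> simp [e]
    fin_cases a
    · exact h3
    · exact hδ1 i
    · exact hδ1 j
  · intro a b hab
    fin_cases a <;> fin_cases b <;>
      first
      | exact absurd rfl hab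
      | (simp [neg_smul, inner_neg_left, inner_neg_right]
         linarith)

end

section
variable {E : Type*} [NormedAddCommGroup E] [InnerProductSpace ℝ E] [FiniteDimensional ℝ E] {k : ℝ}

/-- Gerzon's bound in the plane: the squares `x i ⊗ x i` are independent in a space of
dimension `3`. -/
theorem not_isEquiangularFamily_four {x : Fin 4 → E} (hk : 1 < k)
    (hE : Module.finrank ℝ E = 2) : ¬ IsEquiangularFamily x k := by
  intro h
  set b := (stdOrthonormalBasis ℝ E).reindex (finCongr hE)
  have hin (i j) : ⟪x i, x j⟫ = ⟪b 0, x i⟫ * ⟪b 0, x j⟫ + ⟪b 1, x i⟫ * ⟪b 1, x j⟫ := by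
    rw [← b.sum_inner_mul_inner, Fin.sum_univ_two, real_inner_comm, real_inner_comm (b 1)]
  set y : Fin 4 → EuclideanSpace ℝ (Fin 3) := fun i =>
    !₂[⟪b 0, x i⟫ ^ 2, √2 * (⟪b 0, x i⟫ * ⟪b 1, x i⟫), ⟪b 1, x i⟫ ^ 2]
  have hy (i j) : ⟪y i, y j⟫ = ⟪x i, x j⟫ ^ 2 := by
    have h2 : √2 * √2 = (2 : ℝ) := Real.mul_self_sqrt (by norm_num)
    rw [hin]
    simp only [y, PiLp.inner_apply, Fin.sum_univ_three]
    simp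
    linear_combination (⟪b 0, x i⟫ * ⟪b 1, x i⟫ * (⟪b 0, x j⟫ * ⟪b 1, x j⟫)) * h2
  have hli := linearIndependent_of_inner_eq (x := y) (a := k ^ 2) (b := 1) zero_le_one
    (by nlinarith) (fun i => by rw [hy, h.inner_self]) (fun i j hij => by
      rw [hy]; rcases h.inner_ne i j hij with e | e <;> rw [e] <;> norm_num)
  have := hli.fintype_card_le_finrank
  simp at this

theorem not_isEquiangularFamily_seven_of_finrank_three {x : Fin 7 → E} (hk : 1 < k)
    (hE : Module.finrank ℝ E = 3) : ¬ IsEquiangularFamily x k := by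
  intro h
  have h1 := h.three_le_and_of_two_mul_finrank_lt hk (by simp [hE]) (by simp [hE])
  have h2 := h.relative_bound hk
  simp only [hE, Fintype.card_fin] at h2
  push_cast at h2
  nlinarith

/-- The multiplicity of `-k` is at least `3`, so `k` is an integer; the relative bound leaves `k =
2`, where at most `5` vectors are possible. -/
theorem not_isEquiangularFamily_seven {x : Fin 7 → E} (hk : 1 < k)
    (hE : Module.finrank ℝ E = 4) : ¬ IsEquiangularFamily x k := by
  intro h
  obtain ⟨S, hS, hG⟩ := h.exists_isSeidel
  have h2 := h.relative_bound hk
  simp only [hE, Fintype.card_fin] at h2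
  push_cast at h2
  have hmult := card_le_finrank_add_rootMultiplicity hG
  simp only [hE, Fintype.card_fin] at hmult
  obtain ⟨m, hm⟩ : ∃ m : ℤ, -k = m := by
    by_contra! hne
    have := hS.rootMultiplicity_le_two hne
    omega
  obtain ⟨l, rfl⟩ : ∃ l : ℤ, k = l := ⟨-m, by push_cast; linarith⟩
  have h1 : (1 : ℤ) < l := by exact_mod_cast hk
  rcases (by omega : l = 2 ∨ 3 ≤ l) with rfl | h3
  · have := h.card_le_finrank_add_one (by decide)
    simp [hE] at this
  · have h4 : (3 : ℝ) ≤ l := by exact_mod_cast h3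
    clear * - h2 h4
    nlinarith

theorem not_isEquiangularFamily_eleven {x : Fin 11 → E} (hk : 1 < k)
    (hE : Module.finrank ℝ E = 5) : ¬ IsEquiangularFamily x k := by
  intro h
  have h1 := h.three_le_and_of_two_mul_finrank_lt hk (by simp [hE]) (by simp [hE])
  have h2 := h.relative_bound hk
  simp only [hE, Fintype.card_fin] at h2
  push_cast at h2
  nlinarith

theorem not_isEquiangularFamily_seventeen {x : Fin 17 → E} (hk : 1 < k)
    (hE : Module.finrank ℝ E = 6) : ¬ IsEquiangularFamily x k := by
  intro h
  have h1 := h.three_le_and_of_two_mul_finrank_lt hk (by simp [hE]) (by simp [hE])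
  have h2 := h.relative_bound hk
  simp only [hE, Fintype.card_fin] at h2
  push_cast at h2
  nlinarith

theorem not_isEquiangularFamily_twenty_nine {x : Fin 29 → E} (hk : 1 < k)
    (hE : Module.finrank ℝ E = 7) : ¬ IsEquiangularFamily x k := by
  intro h
  have h1 := h.three_le_and_of_two_mul_finrank_lt hk (by simp [hE]) (by simp [hE])
  have h2 := h.relative_bound hk
  simp only [hE, Fintype.card_fin] at h2
  push_cast at h2
  nlinarith

theorem IsEquiangularFamily.eq_three {ι : Type*} [Fintype ι] {x : ι → E}
    (h : IsEquiangularFamily x k) (hk : 1 < k) (h0 : 0 < Module.finrank ℝ E)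
    (hE : Module.finrank ℝ E ≤ 13) (hι : 28 ≤ Fintype.card ι) : k = 3 := by
  have h1 := h.three_le_and_of_two_mul_finrank_lt hk (by omega) h0
  refine h1.2.resolve_right fun h5 => ?_
  have h2 := h.relative_bound hk
  have h3 : (Module.finrank ℝ E : ℝ) ≤ 13 := by exact_mod_cast hE
  have h4 : (28 : ℝ) ≤ Fintype.card ι := by exact_mod_cast hι
  have h6 : (Module.finrank ℝ E : ℝ) * (k ^ 2 + Fintype.card ι - 1) ≤
      13 * (k ^ 2 + Fintype.card ι - 1) :=
    mul_le_mul_of_nonneg_right h3 (by nlinarith)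
  have h7 : 25 ≤ k ^ 2 := by nlinarith
  nlinarith

end

/-! ### Vectors with inner products zero and minus two -/

section
variable {ι E : Type*} [NormedAddCommGroup E] [InnerProductSpace ℝ E] {y : ι → E}

theorem eq_neg_of_inner_eq_neg {u v : E} {r : ℝ} (hu : ⟪u, u⟫ = r) (hv : ⟪v, v⟫ = r)
    (huv : ⟪u, v⟫ = -r) : u = -v := by
  rw [← add_eq_zero_iff_eq_neg, ← inner_self_eq_zero (𝕜 := ℝ), real_inner_add_add_self]
  linarith

theorem eq_of_inner_eq {u v : E} {r : ℝ} (hu : ⟪u, u⟫ = r) (hv : ⟪v, v⟫ = r)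
    (huv : ⟪u, v⟫ = r) : u = v := by
  rw [← sub_eq_zero, ← inner_self_eq_zero (𝕜 := ℝ), real_inner_sub_sub_self]
  linarith

/-- Bessel's inequality for an orthogonal family and a vector at a constant angle to it, with the
case of equality. -/
theorem card_le_four_of_orthogonal (R : Finset ι) (h2 : ∀ i ∈ R, ⟪y i, y i⟫ = 2)
    (h0 : ∀ i ∈ R, ∀ j ∈ R, i ≠ j → ⟪y i, y j⟫ = 0) {w : E} (hw : ⟪w, w⟫ = 2)
    (h1 : ∀ i ∈ R, ⟪w, y i⟫ = 1) :
    R.card ≤ 4 ∧ (R.card = 4 → w = (1 / 2 : ℝ) • ∑ i ∈ R, y i) := by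
  classical
  set s := ∑ i ∈ R, y i with hs
  have hws : ⟪w, s⟫ = R.card := by
    rw [hs, inner_sum, Finset.sum_congr rfl h1]; simp
  have hss : ⟪s, s⟫ = 2 * R.card := by
    have : ∀ i ∈ R, ⟪y i, s⟫ = 2 := by
      intro i hi
      rw [hs, inner_sum, Finset.sum_eq_single_of_mem i hi fun j hj hji => h0 i hi j hj hji.symm,
        h2 i hi]
    conv_lhs => rw [hs, sum_inner, ← hs]
    rw [Finset.sum_congr rfl this, Finset.sum_const, nsmul_eq_mul, mul_comm]
  have hd : ⟪w - (1 / 2 : ℝ) • s, w - (1 / 2 : ℝ) • s⟫ = 2 - R.card / 2 := by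
    rw [real_inner_sub_sub_self, real_inner_smul_right, real_inner_smul_left,
      real_inner_smul_right, hw, hws, hss]
    ring
  constructor
  · have h3 : (0 : ℝ) ≤ 2 - R.card / 2 := hd ▸ real_inner_self_nonneg
    have : (R.card : ℝ) ≤ 4 := by linarith
    exact_mod_cast this
  · intro h4
    rw [h4] at hd
    exact sub_eq_zero.1 (inner_self_eq_zero (𝕜 := ℝ) |>.1 (by rw [hd]; norm_num))

/-- Vectors of square length `2` with inner products `0` and `-2` are orthogonal up to antipodes. A
vector `w` making inner products `±1` with all of them separates antipodes, and Bessel's inequality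
applies to both halves. -/
theorem card_le_eight (F : Finset ι) (h2 : ∀ i ∈ F, ⟪y i, y i⟫ = 2)
    (h0 : ∀ i ∈ F, ∀ j ∈ F, i ≠ j → ⟪y i, y j⟫ = 0 ∨ ⟪y i, y j⟫ = -2) {w : E}
    (hw : ⟪w, w⟫ = 2) (h1 : ∀ i ∈ F, ⟪w, y i⟫ = 1 ∨ ⟪w, y i⟫ = -1) :
    F.card ≤ 8 ∧ (F.card = 8 → w ∈ Submodule.span ℝ (y '' F) ∧
      ∃ R : Finset ι, R.card ≤ 4 ∧ ∀ i ∈ F, y i ∈ Submodule.span ℝ (y '' R)) := by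
  classical
  set R := F.filter fun i => ⟪w, y i⟫ = 1 with hR
  set Q := F.filter fun i => ¬ ⟪w, y i⟫ = 1 with hQ
  have hcard : R.card + Q.card = F.card := Finset.card_filter_add_card_filter_not _
  have hRF {i} (hi : i ∈ R) : i ∈ F := (Finset.mem_filter.1 hi).1
  have hQF {i} (hi : i ∈ Q) : i ∈ F := (Finset.mem_filter.1 hi).1
  have hR1 {i} (hi : i ∈ R) : ⟪w, y i⟫ = 1 := (Finset.mem_filter.1 hi).2
  have hQ1 {i} (hi : i ∈ Q) : ⟪w, y i⟫ = -1 :=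
    (h1 i (hQF hi)).resolve_left (Finset.mem_filter.1 hi).2
  have hanti {i j} (hi : i ∈ F) (hj : j ∈ F) (hij : ⟪y i, y j⟫ = -2) : ⟪w, y i⟫ = -⟪w, y j⟫ := by
    rw [eq_neg_of_inner_eq_neg (h2 i hi) (h2 j hj) hij, inner_neg_right]
  obtain ⟨hR4, hRw⟩ := card_le_four_of_orthogonal R (fun i hi => h2 i (hRF hi))
    (fun i hi j hj hij => (h0 i (hRF hi) j (hRF hj) hij).resolve_right fun h => by
      have := hanti (hRF hi) (hRF hj) h
      rw [hR1 hi, hR1 hj] at this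
      norm_num at this) hw (fun i hi => hR1 hi)
  obtain ⟨hQ4, -⟩ := card_le_four_of_orthogonal Q (fun i hi => h2 i (hQF hi))
    (fun i hi j hj hij => (h0 i (hQF hi) j (hQF hj) hij).resolve_right fun h => by
      have := hanti (hQF hi) (hQF hj) h
      rw [hQ1 hi, hQ1 hj] at this
      norm_num at this) (w := -w) (by rw [inner_neg_neg, hw])
      (fun i hi => by rw [inner_neg_left, hQ1 hi, neg_neg])
  refine ⟨by omega, fun h8 => ?_⟩
  have hw' := hRw (by omega)
  constructor
  · rw [hw']
    exact Submodule.smul_mem _ _ (Submodule.sum_mem _ fun i hi =>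
      Submodule.subset_span ⟨i, hRF hi, rfl⟩)
  · refine ⟨R, hR4, fun i hi => ?_⟩
    by_cases hiR : i ∈ R
    · exact Submodule.subset_span ⟨i, hiR, rfl⟩
    -- a member of the other half is not orthogonal to `w`, hence is an antipode
    have hiQ : i ∈ Q := Finset.mem_filter.2 ⟨hi, fun h => hiR (Finset.mem_filter.2 ⟨hi, h⟩)⟩
    obtain ⟨j, hj, hji⟩ : ∃ j ∈ R, ⟪y j, y i⟫ ≠ 0 := by
      by_contra! hall
      have h3 := hQ1 hiQ
      rw [hw', real_inner_smul_left, sum_inner, Finset.sum_eq_zero hall] at h3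
      norm_num at h3
    have hne : j ≠ i := by
      rintro rfl
      exact hiR hj
    have h4 := eq_neg_of_inner_eq_neg (h2 j (hRF hj)) (h2 i hi)
      ((h0 j (hRF hj) i hi hne).resolve_left hji)
    rw [show y i = -y j by rw [h4, neg_neg]]
    exact Submodule.neg_mem _ (Submodule.subset_span ⟨j, hj, rfl⟩)

/-- Discarding from each antipodal pair its second, or its first, element leaves an orthogonal
family. -/
theorem card_add_six_le [Fintype ι] [FiniteDimensional ℝ E] (h2 : ∀ i, ⟪y i, y i⟫ = 2)
    (h0 : ∀ i j, i ≠ j → ⟪y i, y j⟫ = 0 ∨ ⟪y i, y j⟫ = -2) {e : Fin 3 → E}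
    (he0 : ∀ a, e a ≠ 0) (he : ∀ a b, a ≠ b → ⟪e a, e b⟫ = 0) (hye : ∀ i a, ⟪y i, e a⟫ = 0) :
    Fintype.card ι + 6 ≤ 2 * Module.finrank ℝ E := by
  classical
  have hbound (R : Finset ι) (hR : ∀ i ∈ R, ∀ j ∈ R, i ≠ j → ⟪y i, y j⟫ = 0) :
      R.card + 3 ≤ Module.finrank ℝ E := by
    have := card_le_finrank_of_orthogonal (x := Sum.elim (fun i : R => y i) e) (by
      rintro (i | a)
      · intro h
        have := h2 i
        rw [Sum.elim_inl] at h
        rw [h, inner_zero_left] at this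
        norm_num at this
      · exact he0 a) (by
      rintro (i | a) (j | b) hij
      · exact hR i i.2 j j.2 fun h => hij (by rw [Subtype.ext h])
      · exact hye i b
      · rw [real_inner_comm]; exact hye j a
      · exact he a b fun h => hij (by rw [h]))
    simpa using this
  let _ : LinearOrder ι := LinearOrder.lift' (Fintype.equivFin ι) (Fintype.equivFin ι).injective
  set R := Finset.univ.filter fun i => ∀ j < i, ⟪y i, y j⟫ ≠ -2 with hR
  set Q := Finset.univ.filter fun i => ∀ j, i < j → ⟪y i, y j⟫ ≠ -2 with hQ
  have hRb := hbound R fun i hi j hj hij => (h0 i j hij).resolve_right fun h => by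
    rcases lt_or_gt_of_ne hij with hlt | hlt
    · exact (Finset.mem_filter.1 hj).2 i hlt (by rw [real_inner_comm, h])
    · exact (Finset.mem_filter.1 hi).2 j hlt h
  have hQb := hbound Q fun i hi j hj hij => (h0 i j hij).resolve_right fun h => by
    rcases lt_or_gt_of_ne hij with hlt | hlt
    · exact (Finset.mem_filter.1 hi).2 j hlt h
    · exact (Finset.mem_filter.1 hj).2 i hlt (by rw [real_inner_comm, h])
  have hcover : (Finset.univ : Finset ι) ⊆ R ∪ Q := by
    intro i _
    by_contra hi
    simp only [Finset.mem_union, hR, hQ, Finset.mem_filter, Finset.mem_univ, true_and, not_or,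
      not_forall, not_not] at hi
    obtain ⟨⟨j, hj, hij⟩, ⟨l, hl, hil⟩⟩ := hi
    have e1 := eq_neg_of_inner_eq_neg (h2 i) (h2 j) hij
    have e2 := eq_neg_of_inner_eq_neg (h2 i) (h2 l) hil
    have e3 : y j = y l := neg_injective (e1.symm.trans e2)
    have h4 := h0 j l (hj.trans hl).ne
    rw [e3, h2] at h4
    norm_num at h4
  have h5 := (Finset.card_le_card hcover).trans (Finset.card_union_le R Q)
  rw [Finset.card_univ] at h5
  omega

end

/-! ### Pillars -/

/-- Three vectors of square length `3` with inner products `-1` and the negative of their sum form a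
regular tetrahedron. -/
theorem inner_neg_sum_of_inner_eq_neg_one {E : Type*} [NormedAddCommGroup E]
    [InnerProductSpace ℝ E] {p : Fin 3 → E} (hp : ∀ a, ⟪p a, p a⟫ = 3)
    (hpp : ∀ a b, a ≠ b → ⟪p a, p b⟫ = -1) :
    (∀ a, ⟪p a, -(p 0 + p 1 + p 2)⟫ = -1) ∧
      ⟪-(p 0 + p 1 + p 2), -(p 0 + p 1 + p 2)⟫ = 3 := by
  have h (a) : ⟪p a, -(p 0 + p 1 + p 2)⟫ = -1 := by
    rw [inner_neg_right, inner_add_right, inner_add_right]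
    fin_cases a <;> simp only [Fin.zero_eta, Fin.mk_one, Fin.reduceFinMk] <;>
      simp only [hp, hpp 0 1 (by decide), hpp 0 2 (by decide), hpp 1 0 (by decide),
        hpp 1 2 (by decide), hpp 2 0 (by decide), hpp 2 1 (by decide)] <;> norm_num
  refine ⟨h, ?_⟩
  rw [inner_neg_left, inner_add_left, inner_add_left, h, h, h]
  norm_num

section
variable {ι E : Type*} [NormedAddCommGroup E] [InnerProductSpace ℝ E] [FiniteDimensional ℝ E]
  {x : ι → E}

/-- The decomposition into pillars. The base consists of `p 0`, `p 1`, `p 2` and the negative `q` of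
their sum; `c i` names the pillar of `x i`. -/
theorem card_eq_of_pillars [Fintype ι] (hx : IsEquiangularFamily x 3) {p : Fin 3 → E} {q : E}
    (hp : ∀ a, ⟪p a, p a⟫ = 3) (hpp : ∀ a b, a ≠ b → ⟪p a, p b⟫ = -1)
    (hq : q = -(p 0 + p 1 + p 2)) (hxq : ∀ i, ⟪x i, q⟫ = 1)
    (hxp : ∀ i a, ⟪x i, p a⟫ = 1 ∨ ⟪x i, p a⟫ = -1)
    (hE : Module.finrank ℝ E ≤ 13) (hι : 24 ≤ Fintype.card ι) :
    Fintype.card ι = 24 ∧ ∃ W : Submodule ℝ E, Module.finrank ℝ W ≤ 7 ∧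
      (∀ i, x i ∈ W) ∧ ∀ a, p a ∈ W := by
  classical
  have hc (i) : ∃ c, ∀ a, ⟪x i, p a⟫ = if a = c then 1 else -1 := by
    have h1 := hxq i
    rw [hq, inner_neg_right, inner_add_right, inner_add_right] at h1
    rcases hxp i 0 with e0 | e0 <;> rcases hxp i 1 with e1 | e1 <;>
      rcases hxp i 2 with e2 | e2 <;> rw [e0, e1, e2] at h1 <;> norm_num at h1
    · exact ⟨0, fun a => by fin_cases a <;> simp [e0, e1, e2]⟩
    · exact ⟨1, fun a => by fin_cases a <;> simp [e0, e1, e2]⟩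
    · exact ⟨2, fun a => by fin_cases a <;> simp [e0, e1, e2]⟩
  choose c hc using hc
  obtain ⟨hpq, hqq⟩ := inner_neg_sum_of_inner_eq_neg_one hp hpp
  rw [← hq] at hqq
  simp only [← hq] at hpq
  -- the orthogonal projections of the pillars to the span of the base
  set h : Fin 3 → E := fun a => (1 / 2 : ℝ) • (q + p a) with hh
  have hhh (a b) : ⟪h a, h b⟫ = if a = b then 1 else 0 := by
    simp only [hh, real_inner_smul_left, real_inner_smul_right, inner_add_left, inner_add_right,
      hqq, hpq, real_inner_comm (p _) q]
    by_cases hab : a = b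
    · subst hab
      rw [hp, if_pos rfl]; norm_num
    · rw [hpp a b hab, if_neg hab]; norm_num
  have hxh (i a) : ⟪x i, h a⟫ = if a = c i then 1 else 0 := by
    simp only [hh, real_inner_smul_right, inner_add_right, hxq, hc]
    split_ifs <;> norm_num
  set y : ι → E := fun i => x i - h (c i) with hy
  have hyh (i a) : ⟪y i, h a⟫ = 0 := by
    rw [hy, inner_sub_left, hxh, hhh, sub_eq_zero]
    simp only [eq_comm]
  have hyy (i j) : ⟪y i, y j⟫ = ⟪x i, x j⟫ - if c i = c j then 1 else 0 := by
    conv_lhs => rw [hy]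
    rw [inner_sub_right, hyh, sub_zero, inner_sub_left, real_inner_comm, real_inner_comm (x j),
      hxh]
  have hyself (i) : ⟪y i, y i⟫ = 2 := by
    rw [hyy, hx.inner_self, if_pos rfl]; norm_num
  have hysame (i j) (hij : i ≠ j) (hcij : c i = c j) : ⟪y i, y j⟫ = 0 ∨ ⟪y i, y j⟫ = -2 := by
    rw [hyy, if_pos hcij]
    rcases hx.inner_ne i j hij with e | e <;> rw [e] <;> norm_num
  have hydiff (i j) (hcij : c i ≠ c j) : ⟪y i, y j⟫ = 1 ∨ ⟪y i, y j⟫ = -1 := by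
    rw [hyy, if_neg hcij, sub_zero]
    exact hx.inner_ne i j fun e => hcij (by rw [e])
  -- a single pillar is small
  obtain ⟨i₁, i₂, h12⟩ : ∃ i j, c i ≠ c j := by
    by_contra! hall
    have := card_add_six_le hyself (fun i j hij => hysame i j hij (hall i j)) (e := h)
      (fun a h0 => by
        have := hhh a a
        rw [h0, inner_zero_left, if_pos rfl] at this
        norm_num at this)
      (fun a b hab => by rw [hhh, if_neg hab]) hyh
    omega
  set F : Fin 3 → Finset ι := fun a => Finset.univ.filter fun i => c i = a with hF
  have hmem {a i} : i ∈ F a ↔ c i = a := by simp [hF]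
  have hsum : ∑ a, (F a).card = Fintype.card ι :=
    (Finset.card_eq_sum_card_fiberwise fun i _ => Finset.mem_coe.2 (Finset.mem_univ (c i))).symm
  have height (a) {w : ι} (hw : c w ≠ a) := card_le_eight (y := y) (F a) (fun i _ => hyself i)
    (fun i hi j hj hij => hysame i j hij ((hmem.1 hi).trans (hmem.1 hj).symm)) (hyself w)
    (fun i hi => hydiff w i (by rw [hmem.1 hi]; exact hw))
  have hother (a) : ∃ w, c w ≠ a := by
    by_contra! hall
    exact h12 (by rw [hall, hall])
  have hF8 (a) : (F a).card ≤ 8 := by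
    obtain ⟨w, hw⟩ := hother a
    exact (height a hw).1
  rw [Fin.sum_univ_three] at hsum
  have h0 := hF8 0
  have h1 := hF8 1
  have h2 := hF8 2
  refine ⟨by omega, ?_⟩
  have hF0 : (F 0).card = 8 := by omega
  obtain ⟨w, hw⟩ := hother 0
  obtain ⟨-, R, hR4, hR⟩ := (height 0 hw).2 hF0
  set T : Finset E := R.image y ∪ Finset.univ.image h with hT
  have hTcard : T.card ≤ 7 := by
    have e1 : T.card ≤ _ := Finset.card_union_le (R.image y) (Finset.univ.image h)
    have e2 := Finset.card_image_le (s := R) (f := y)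
    have e3 := Finset.card_image_le (s := Finset.univ) (f := h)
    simp only [Finset.card_univ, Fintype.card_fin] at e3
    omega
  have hhW (a) : h a ∈ Submodule.span ℝ (T : Set E) :=
    Submodule.subset_span (by simp [hT])
  have hRW : Submodule.span ℝ (y '' R) ≤ Submodule.span ℝ (T : Set E) :=
    Submodule.span_mono (by simp [hT])
  have hyW (i) : y i ∈ Submodule.span ℝ (T : Set E) := by
    by_cases hi : c i = 0
    · exact hRW (hR i (hmem.2 hi))
    · have h3 : y '' (F 0) ⊆ Submodule.span ℝ (T : Set E) := by
        rintro _ ⟨j, hj, rfl⟩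
        exact hRW (hR j hj)
      exact Submodule.span_le.2 h3 ((height 0 hi).2 hF0).1
  refine ⟨Submodule.span ℝ (T : Set E), (finrank_span_finset_le_card T).trans hTcard, ?_, ?_⟩
  · intro i
    have : x i = y i + h (c i) := by simp [hy]
    rw [this]
    exact Submodule.add_mem _ (hyW i) (hhW _)
  · have e (a b d : Fin 3) (hs : q = -(p a + p b + p d)) : p a = h a - h b - h d := by
      simp only [hh, hs]
      module
    intro a
    have h3 : ∃ b d, q = -(p a + p b + p d) := by
      fin_cases a
      · exact ⟨1, 2, hq⟩
      · exact ⟨0, 2, by rw [hq]; simp only [Fin.mk_one]; abel⟩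
      · exact ⟨0, 1, by rw [hq]; simp only [Fin.reduceFinMk]; abel⟩
    obtain ⟨b, d, hs⟩ := h3
    rw [e a b d hs]
    exact Submodule.sub_mem _ (Submodule.sub_mem _ (hhW a) (hhW b)) (hhW d)

/-- At most `28` lines with cosine `1/3` fit in dimension `13`, and `28` of them only span a space
of dimension `7`. Three of the lines, with negative inner products, determine a base: the negative
of their sum may be adjoined to the system. -/
theorem IsEquiangularFamily.card_eq_and_finrank_span_le [Fintype ι] (hx : IsEquiangularFamily x 3)
    (hE : Module.finrank ℝ E ≤ 13) (hι : 28 ≤ Fintype.card ι) :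
    Fintype.card ι = 28 ∧ Module.finrank ℝ (Submodule.span ℝ (Set.range x)) ≤ 7 := by
  classical
  obtain ⟨f, ε, hf, hε, hneg⟩ := hx.exists_triple (by norm_num) fun hli => by
    have := hli.fintype_card_le_finrank
    omega
  set p : Fin 3 → E := fun a => ε a • x (f a) with hp
  have hpx (a) : p a = x (f a) ∨ p a = -x (f a) := by
    rcases hε a with e | e <;> simp [hp, e]
  have hpp (a) : ⟪p a, p a⟫ = 3 := by
    rcases hpx a with e | e <;> simp only [e, inner_neg_neg, hx.inner_self]
  set q := -(p 0 + p 1 + p 2) with hq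
  have hqq : ⟪q, q⟫ = 3 := (inner_neg_sum_of_inner_eq_neg_one hpp hneg).2
  have hxp (i) (hi : ∀ a, i ≠ f a) (a) : ⟪x i, p a⟫ = 1 ∨ ⟪x i, p a⟫ = -1 := by
    have h1 := hx.inner_ne i (f a) (hi a)
    rcases hpx a with e | e <;> rw [e]
    · exact h1
    · rw [inner_neg_right]
      rcases h1 with h | h <;> simp [h]
  have hxq (i) (hi : ∀ a, i ≠ f a) (h1 : x i ≠ q) (h2 : x i ≠ -q) :
      ⟪x i, q⟫ = 1 ∨ ⟪x i, q⟫ = -1 := by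
    have h3 : ⟪x i, q⟫ ≠ 3 := fun h => h1 (eq_of_inner_eq (hx.inner_self i) hqq h)
    have h4 : ⟪x i, q⟫ ≠ -3 := fun h => h2 (eq_neg_of_inner_eq_neg (hx.inner_self i) hqq h)
    rw [hq, inner_neg_right, inner_add_right, inner_add_right] at h3 h4 ⊢
    rcases hxp i hi 0 with e0 | e0 <;> rcases hxp i hi 1 with e1 | e1 <;>
      rcases hxp i hi 2 with e2 | e2 <;> rw [e0, e1, e2] at h3 h4 ⊢ <;>
      revert h3 h4 <;> norm_num
  set U : Finset ι := Finset.univ.filter fun i => x i = q ∨ x i = -q with hU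
  have hU1 : U.card ≤ 1 := by
    rw [Finset.card_le_one]
    intro i hi j hj
    by_contra hij
    have h1 := hx.inner_ne i j hij
    rcases (Finset.mem_filter.1 hi).2 with e | e <;>
      rcases (Finset.mem_filter.1 hj).2 with g | g <;>
      rw [e, g] at h1 <;>
      simp only [inner_neg_left, inner_neg_right, hqq] at h1 <;> norm_num at h1
  set B : Finset ι := Finset.univ.image f ∪ U with hB
  have hB4 : B.card ≤ 4 := by
    have e1 : B.card ≤ _ := Finset.card_union_le (Finset.univ.image f) U
    have e2 := Finset.card_image_le (s := Finset.univ) (f := f)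
    simp only [Finset.card_univ, Fintype.card_fin] at e2
    omega
  have hBmem (i) (hi : i ∉ B) : (∀ a, i ≠ f a) ∧ x i ≠ q ∧ x i ≠ -q := by
    simp only [hB, hU, Finset.mem_union, Finset.mem_image, Finset.mem_univ, true_and,
      Finset.mem_filter, not_or, not_exists] at hi
    exact ⟨fun a h => hi.1 a h.symm, hi.2⟩
  have hcompl := Finset.card_add_card_compl B
  have hx' : IsEquiangularFamily (fun i : {i // i ∉ B} => ⟪x i, q⟫ • x i) 3 :=
    (hx.comp (fun i : {i // i ∉ B} => (i : ι)) Subtype.val_injective).smul_sign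
      fun i => hxq i (hBmem i i.2).1 (hBmem i i.2).2.1 (hBmem i i.2).2.2
  have hsign (i : {i // i ∉ B}) : ⟪x i, q⟫ = 1 ∨ ⟪x i, q⟫ = -1 :=
    hxq i (hBmem i i.2).1 (hBmem i i.2).2.1 (hBmem i i.2).2.2
  have hcard : Fintype.card {i // i ∉ B} = Bᶜ.card := by
    rw [Fintype.card_subtype]
    congr 1
    ext i
    simp
  obtain ⟨h24, W, hW7, hxW, hpW⟩ := card_eq_of_pillars hx' hpp hneg hq
    (fun i => by
      rw [real_inner_smul_left]
      rcases hsign i with e | e <;> rw [e] <;> norm_num)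
    (fun i a => by
      rw [real_inner_smul_left]
      rcases hsign i with e | e <;> rcases hxp i (hBmem i i.2).1 a with g | g <;>
        rw [e, g] <;> norm_num) hE (by omega)
  refine ⟨by omega, le_trans (Submodule.finrank_mono (Submodule.span_le.2 ?_)) hW7⟩
  rintro _ ⟨i, rfl⟩
  have hqW : q ∈ W := W.neg_mem (W.add_mem (W.add_mem (hpW 0) (hpW 1)) (hpW 2))
  by_cases hi : i ∈ B
  · simp only [hB, hU, Finset.mem_union, Finset.mem_image, Finset.mem_univ, true_and,
      Finset.mem_filter] at hi
    rcases hi with ⟨a, rfl⟩ | h | h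
    · rcases hpx a with e | e
      · exact e ▸ hpW a
      · have := W.neg_mem (hpW a)
        rwa [e, neg_neg] at this
    · exact h ▸ hqW
    · exact h ▸ W.neg_mem hqW
  · have := hxW ⟨i, hi⟩
    rcases hsign ⟨i, hi⟩ with e | e
    · simpa [e] using this
    · simp only [e, neg_smul, one_smul] at this
      simpa using W.neg_mem this

end

/-! ### Maximal numbers of equiangular lines -/

section
variable {E : Type*} [NormedAddCommGroup E] [InnerProductSpace ℝ E]

theorem span_singleton_eq_of_eq_or_eq_neg {u v : E} (h : u = v ∨ u = -v) :
    Submodule.span ℝ {u} = Submodule.span ℝ {v} := by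
  rcases h with rfl | rfl
  · rfl
  · rw [← Set.neg_singleton, Submodule.span_neg]

theorem eq_or_eq_neg_of_span_singleton_eq {u v : E} {r : ℝ} (hr : r ≠ 0) (hu : ⟪u, u⟫ = r)
    (hv : ⟪v, v⟫ = r) (h : Submodule.span ℝ {u} = Submodule.span ℝ {v}) : u = v ∨ u = -v := by
  have h1 : u ∈ Submodule.span ℝ {v} := h ▸ Submodule.mem_span_singleton_self u
  obtain ⟨c, rfl⟩ := Submodule.mem_span_singleton.1 h1
  rw [real_inner_smul_left, real_inner_smul_right, hv] at hu
  have h2 : c * c = 1 := by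
    refine mul_right_cancel₀ hr ?_
    linarith
  rcases mul_self_eq_one_iff.1 h2 with rfl | rfl
  · simp
  · simp

theorem exists_unit_span_eq {L : Submodule ℝ E} (hL : Module.finrank ℝ L = 1) :
    ∃ u : E, ‖u‖ = 1 ∧ Submodule.span ℝ {u} = L := by
  obtain ⟨v, hv, h⟩ := finrank_eq_one_iff'.1 hL
  have hv0 : (v : E) ≠ 0 := fun h => hv (Subtype.ext h)
  refine ⟨(‖(v : E)‖⁻¹ : ℝ) • (v : E), norm_smul_inv_norm hv0, ?_⟩
  have hn : (‖(v : E)‖⁻¹ : ℝ) ≠ 0 := inv_ne_zero (norm_ne_zero_iff.2 hv0)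
  rw [Submodule.span_singleton_smul_eq (IsUnit.mk0 _ hn)]
  apply le_antisymm
  · rw [Submodule.span_le, Set.singleton_subset_iff]
    exact v.2
  · intro w hw
    obtain ⟨c, hc⟩ := h ⟨w, hw⟩
    exact Submodule.mem_span_singleton.2 ⟨c, congrArg Subtype.val hc⟩

/-- Equiangular lines are orthogonal, or supported by an equiangular family of vectors. -/
theorem IsEquiangular.exists_family {X : Set (Submodule ℝ E)} (hX : IsEquiangular X) {ι : Type*}
    [Nontrivial ι] {e : ι → Submodule ℝ E} (he : Function.Injective e) (heX : ∀ i, e i ∈ X) :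
    (∃ x : ι → E, (∀ i, x i ≠ 0) ∧ ∀ i j, i ≠ j → ⟪x i, x j⟫ = 0) ∨
      ∃ (x : ι → E) (k : ℝ), 1 < k ∧ IsEquiangularFamily x k ∧
        ∀ i, Submodule.span ℝ {x i} = e i := by
  obtain ⟨h1, θ, hθ, hang⟩ := hX
  choose u hu1 hu using fun i => exists_unit_span_eq (h1 _ (heX i))
  have hmem (i) : u i ∈ e i := hu i ▸ Submodule.mem_span_singleton_self (u i)
  have huu (i) : ⟪u i, u i⟫ = 1 := by rw [real_inner_self_eq_norm_sq, hu1]; norm_num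
  have hα0 : 0 ≤ Real.cos θ :=
    Real.cos_nonneg_of_mem_Icc ⟨by linarith [hθ.1, Real.pi_pos], hθ.2⟩
  set α := Real.cos θ with hα
  have hin (i j) (hij : i ≠ j) : |⟪u i, u j⟫| = α := by
    rw [hang _ (heX i) _ (heX j) (he.ne hij) _ (hmem i) _ (hmem j), hu1, hu1]
    ring
  have hα1 : α < 1 := by
    refine lt_of_le_of_ne (Real.cos_le_one θ) fun h => ?_
    obtain ⟨i, j, hij⟩ := exists_pair_ne ι
    have h2 := hin i j hij
    rw [h] at h2
    refine he.ne hij ?_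
    rw [← hu i, ← hu j]
    apply span_singleton_eq_of_eq_or_eq_neg
    rcases (abs_eq zero_le_one).1 h2 with h3 | h3
    · exact Or.inl (eq_of_inner_eq (huu i) (huu j) h3)
    · exact Or.inr (eq_neg_of_inner_eq_neg (huu i) (huu j) h3)
  rcases hα0.eq_or_lt with h0 | h0
  · refine Or.inl ⟨u, fun i h => ?_, fun i j hij => ?_⟩
    · have := hu1 i
      rw [h, norm_zero] at this
      norm_num at this
    · have := hin i j hij
      rwa [← h0, abs_eq_zero] at this
  · refine Or.inr ⟨fun i => √α⁻¹ • u i, α⁻¹, (one_lt_inv₀ h0).2 hα1,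
      ⟨fun i => ?_, fun i j hij => ?_⟩, fun i => ?_⟩
    · rw [real_inner_smul_left, real_inner_smul_right, huu, mul_one,
        Real.mul_self_sqrt (inv_nonneg.2 hα0)]
    · rw [real_inner_smul_left, real_inner_smul_right, ← mul_assoc,
        Real.mul_self_sqrt (inv_nonneg.2 hα0)]
      rcases (abs_eq hα0).1 (hin i j hij) with h | h <;> rw [h]
      · exact Or.inl (inv_mul_cancel₀ h0.ne')
      · exact Or.inr (by rw [mul_neg, inv_mul_cancel₀ h0.ne'])
    · rw [← hu i]
      exact Submodule.span_singleton_smul_eq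
        (IsUnit.mk0 _ (Real.sqrt_ne_zero'.2 (inv_pos.2 h0))) _

theorem exists_injective_of_le_encard {α : Type*} {X : Set α} {N : ℕ} (h : (N : ℕ∞) ≤ X.encard) :
    ∃ e : Fin N → α, Function.Injective e ∧ (∀ i, e i ∈ X) ∧
      (X.encard = N → ∀ x ∈ X, ∃ i, e i = x) := by
  obtain ⟨t, htX, ht⟩ := Set.exists_subset_encard_eq h
  have hfin : t.Finite := Set.finite_of_encard_eq_coe ht
  have hcard : hfin.toFinset.card = N := by
    rw [hfin.encard_eq_coe_toFinset_card] at ht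
    exact_mod_cast ht
  set φ := hfin.toFinset.equivFinOfCardEq hcard
  refine ⟨fun i => φ.symm i, Subtype.val_injective.comp φ.symm.injective, fun i => ?_, ?_⟩
  · exact htX (hfin.mem_toFinset.1 (φ.symm i).2)
  · intro hX x hx
    have : t = X := hfin.eq_of_subset_of_encard_le htX (by rw [hX, ht])
    exact ⟨φ ⟨x, hfin.mem_toFinset.2 (this ▸ hx)⟩, by simp⟩

theorem IsEquiangular.encard_le [FiniteDimensional ℝ E] {X : Set (Submodule ℝ E)}
    (hX : IsEquiangular X) {N : ℕ} (hN : Module.finrank ℝ E ≤ N) (hN1 : 1 ≤ N)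
    (h : ∀ (x : Fin (N + 1) → E) (k : ℝ), 1 < k → ¬ IsEquiangularFamily x k) :
    X.encard ≤ N := by
  by_contra! hlt
  obtain ⟨e, he, heX, -⟩ := exists_injective_of_le_encard (N := N + 1)
    (by push_cast; exact Order.add_one_le_of_lt hlt)
  have : Nontrivial (Fin (N + 1)) := Fin.nontrivial_iff_two_le.2 (by omega)
  rcases hX.exists_family he heX with ⟨x, hx0, hx⟩ | ⟨x, k, hk, hx, -⟩
  · have := card_le_finrank_of_orthogonal hx0 hx
    simp at this
    omega
  · exact h x k hk hx

theorem isEquiangular_image_span {s : Set E} {k r : ℝ} (hr : 0 ≤ r) (hk : r < k)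
    (h0 : ∀ x ∈ s, ⟪x, x⟫ = k)
    (h : ∀ x ∈ s, ∀ y ∈ s, x ≠ y → x ≠ -y → ⟪x, y⟫ = r ∨ ⟪x, y⟫ = -r) :
    IsEquiangular ((fun x : E => Submodule.span ℝ {x}) '' s) := by
  have hk0 : 0 < k := by linarith
  have hrk : 0 ≤ r / k := by positivity
  refine ⟨?_, Real.arccos (r / k), ⟨Real.arccos_nonneg _, Real.arccos_le_pi_div_two.2 hrk⟩, ?_⟩
  · rintro _ ⟨x, hx, rfl⟩
    refine finrank_span_singleton fun h1 => ?_
    have := h0 x hx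
    rw [h1, inner_zero_left] at this
    linarith
  · rintro _ ⟨x, hx, rfl⟩ _ ⟨y, hy, rfl⟩ hne a ha b hb
    obtain ⟨c, rfl⟩ := Submodule.mem_span_singleton.1 ha
    obtain ⟨d, rfl⟩ := Submodule.mem_span_singleton.1 hb
    have hxy := h x hx y hy (fun e => hne (span_singleton_eq_of_eq_or_eq_neg (Or.inl e)))
      (fun e => hne (span_singleton_eq_of_eq_or_eq_neg (Or.inr e)))
    have hnorm {z : E} (hz : ⟪z, z⟫ = k) : ‖z‖ = √k := by
      rw [← hz, real_inner_self_eq_norm_sq, Real.sqrt_sq (norm_nonneg _)]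
    rw [Real.cos_arccos (by linarith) ((div_le_one hk0).2 hk.le),
      real_inner_smul_left, real_inner_smul_right, norm_smul, norm_smul, hnorm (h0 x hx),
      hnorm (h0 y hy), abs_mul, abs_mul]
    have h1 : |⟪x, y⟫| = r := by rcases hxy with e | e <;> rw [e] <;> simp [hr]
    rw [h1, Real.norm_eq_abs, Real.norm_eq_abs]
    have h2 : √k * √k * (r / k) = r := by
      rw [Real.mul_self_sqrt hk0.le, mul_div_cancel₀ _ hk0.ne']
    linear_combination (-(|c| * |d|)) * h2

theorem le_encard_image_span {s : Set E} {k : ℝ} (hk : k ≠ 0) (h0 : ∀ x ∈ s, ⟪x, x⟫ = k)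
    {N : ℕ} (x : Fin N → E) (hxs : ∀ i, x i ∈ s)
    (hx : ∀ i j, i ≠ j → x i ≠ x j ∧ x i ≠ -x j) :
    (N : ℕ∞) ≤ ((fun x : E => Submodule.span ℝ {x}) '' s).encard := by
  have hinj : Function.Injective fun i => Submodule.span ℝ {x i} := by
    intro i j hij
    by_contra hne
    rcases eq_or_eq_neg_of_span_singleton_eq hk (h0 _ (hxs i)) (h0 _ (hxs j)) hij with e | e
    · exact (hx i j hne).1 e
    · exact (hx i j hne).2 e
  have h1 := Set.encard_le_encard (s := Set.range fun i => Submodule.span ℝ {x i})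
    (t := (fun x : E => Submodule.span ℝ {x}) '' s) (by
      rintro _ ⟨i, rfl⟩
      exact ⟨x i, hxs i, rfl⟩)
  rwa [← Set.image_univ, hinj.encard_image, Set.encard_univ, ENat.card_eq_coe_fintype_card,
    Fintype.card_fin] at h1

end

theorem IsEquiangular.encard_le_maxEquiangular {n : ℕ}
    {X : Set (Submodule ℝ (EuclideanSpace ℝ (Fin n)))} (hX : IsEquiangular X) :
    X.encard ≤ maxEquiangular n :=
  le_sSup ⟨X, hX, rfl⟩

theorem IsEquiangular.encard_le_maxSpanningEquiangular {n : ℕ}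
    {X : Set (Submodule ℝ (EuclideanSpace ℝ (Fin n)))} (hX : IsEquiangular X) (hs : sSup X = ⊤) :
    X.encard ≤ maxSpanningEquiangular n :=
  le_sSup ⟨X, hX, hs, rfl⟩

theorem maxSpanningEquiangular_le_maxEquiangular (n : ℕ) :
    maxSpanningEquiangular n ≤ maxEquiangular n := by
  refine sSup_le ?_
  rintro _ ⟨X, hX, -, rfl⟩
  exact hX.encard_le_maxEquiangular

theorem maxEquiangular_le {n N : ℕ} (hN : n ≤ N) (hN1 : 1 ≤ N)
    (h : ∀ (x : Fin (N + 1) → EuclideanSpace ℝ (Fin n)) (k : ℝ), 1 < k →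
      ¬ IsEquiangularFamily x k) : maxEquiangular n ≤ N := by
  refine sSup_le ?_
  rintro _ ⟨X, hX, rfl⟩
  exact hX.encard_le (by simpa using hN) hN1 h

theorem maxEquiangular_two_le : maxEquiangular 2 ≤ 3 :=
  maxEquiangular_le (by norm_num) (by norm_num)
    fun _ _ hk => not_isEquiangularFamily_four hk (by simp)

theorem maxEquiangular_three_le : maxEquiangular 3 ≤ 6 :=
  maxEquiangular_le (by norm_num) (by norm_num)
    fun _ _ hk => not_isEquiangularFamily_seven_of_finrank_three hk (by simp)

theorem maxEquiangular_four_le : maxEquiangular 4 ≤ 6 :=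
  maxEquiangular_le (by norm_num) (by norm_num)
    fun _ _ hk => not_isEquiangularFamily_seven hk (by simp)

theorem maxEquiangular_five_le : maxEquiangular 5 ≤ 10 :=
  maxEquiangular_le (by norm_num) (by norm_num)
    fun _ _ hk => not_isEquiangularFamily_eleven hk (by simp)

theorem maxEquiangular_six_le : maxEquiangular 6 ≤ 16 :=
  maxEquiangular_le (by norm_num) (by norm_num)
    fun _ _ hk => not_isEquiangularFamily_seventeen hk (by simp)

theorem maxEquiangular_seven_le : maxEquiangular 7 ≤ 28 :=
  maxEquiangular_le (by norm_num) (by norm_num)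
    fun _ _ hk => not_isEquiangularFamily_twenty_nine hk (by simp)

theorem maxEquiangular_le_twenty_eight {n : ℕ} (h0 : 0 < n) (hn : n ≤ 13) :
    maxEquiangular n ≤ 28 := by
  refine maxEquiangular_le (N := 28) (by omega) (by norm_num) fun x k hk hx => ?_
  obtain rfl := hx.eq_three hk (by simpa using h0) (by simpa using hn) (by simp)
  have := (hx.card_eq_and_finrank_span_le (by simpa using hn) (by simp)).1
  simp at this

/-- By `maxEquiangular_le_twenty_eight` a spanning set of `28` lines would be finite, and its span
would have dimension at most `7`. -/
theorem maxSpanningEquiangular_lt {n : ℕ} (h8 : 8 ≤ n) (hn : n ≤ 13) :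
    maxSpanningEquiangular n < 28 := by
  refine lt_of_le_of_lt (b := 27) (sSup_le ?_) (by norm_num)
  rintro _ ⟨X, hX, hs, rfl⟩
  by_contra! hlt
  have h28 : ((28 : ℕ) : ℕ∞) ≤ X.encard := by
    have := Order.add_one_le_of_lt hlt
    norm_num at this
    exact this
  have hle := hX.encard_le_maxEquiangular.trans (maxEquiangular_le_twenty_eight (by omega) hn)
  obtain ⟨e, he, heX, hsurj⟩ := exists_injective_of_le_encard h28
  have hsurj := hsurj (le_antisymm hle h28)
  rcases hX.exists_family he heX with ⟨x, hx0, hx⟩ | ⟨x, k, hk, hx, hxe⟩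
  · have := card_le_finrank_of_orthogonal hx0 hx
    simp at this
    omega
  · obtain rfl := hx.eq_three hk (by simp; omega) (by simpa using hn) (by simp)
    have h7 := (hx.card_eq_and_finrank_span_le (by simpa using hn) (by simp)).2
    have htop : Submodule.span ℝ (Set.range x) = ⊤ := by
      rw [eq_top_iff, ← hs]
      refine sSup_le fun L hL => ?_
      obtain ⟨i, rfl⟩ := hsurj L hL
      rw [← hxe i]
      exact Submodule.span_mono (by simp)
    rw [htop, finrank_top, finrank_euclideanSpace_fin] at h7
    omega

theorem maxEquiangular_mono {m n : ℕ} (h : m ≤ n) : maxEquiangular m ≤ maxEquiangular n := by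
  set v := EuclideanSpace.basisFun (Fin m) ℝ
  set w := EuclideanSpace.basisFun (Fin n) ℝ
  have hf : v.toBasis.constr ℝ (fun i => w (Fin.castLE h i)) ∘ v.toBasis =
      fun i => w (Fin.castLE h i) := by
    ext1 i
    simp only [Function.comp_apply, Module.Basis.constr_basis]
  let f := (v.toBasis.constr ℝ fun i => w (Fin.castLE h i)).isometryOfOrthonormal
    (v := v.toBasis) (by simp)
    (by rw [hf]; exact w.orthonormal.comp _ (Fin.castLE_injective h))
  refine sSup_le ?_
  rintro _ ⟨X, ⟨h1, θ, hθ, hX⟩, rfl⟩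
  have hinj : Function.Injective (Submodule.map f.toLinearMap) :=
    Submodule.map_injective_of_injective f.injective
  rw [← hinj.encard_image X]
  refine IsEquiangular.encard_le_maxEquiangular ⟨?_, θ, hθ, ?_⟩
  · rintro _ ⟨L, hL, rfl⟩
    exact (Submodule.equivMapOfInjective f.toLinearMap f.injective L).finrank_eq.symm.trans
      (h1 L hL)
  · rintro _ ⟨L, hL, rfl⟩ _ ⟨M, hM, rfl⟩ hne _ ⟨x, hx, rfl⟩ _ ⟨y, hy, rfl⟩
    have := hX L hL M hM (fun h => hne (by rw [h])) x hx y hy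
    simpa using this

/-! ### Lattices generated by equiangular vectors -/

section
variable {E : Type*} [NormedAddCommGroup E] [InnerProductSpace ℝ E]

theorem isFullLattice_span {ι : Type*} [Finite ι] [FiniteDimensional ℝ E]
    (b : Module.Basis ι ℝ E) :
    IsFullLattice (Submodule.span ℤ (Set.range b)) :=
  ⟨inferInstance, inferInstance⟩

theorem minimalVectors_eq {Λ : Submodule ℤ E} {k : ℝ} (hk : 0 < k)
    (h : ∀ x ∈ Λ, x ≠ 0 → k ≤ ⟪x, x⟫) {v : E} (hv : v ∈ Λ) (hvk : ⟪v, v⟫ = k) :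
    minimalVectors Λ = {x | x ∈ Λ ∧ ⟪x, x⟫ = k} := by
  have hv0 : v ≠ 0 := by
    rintro rfl
    rw [inner_zero_left] at hvk
    exact hk.ne hvk
  have hiff (x y : E) : ‖x‖ ≤ ‖y‖ ↔ ⟪x, x⟫ ≤ ⟪y, y⟫ := by
    rw [real_inner_self_eq_norm_sq, real_inner_self_eq_norm_sq,
      pow_le_pow_iff_left₀ (norm_nonneg _) (norm_nonneg _) two_ne_zero]
  ext x
  constructor
  · rintro ⟨hx, hx0, hmin⟩
    refine ⟨hx, le_antisymm ?_ (h x hx hx0)⟩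
    rw [← hvk]
    exact (hiff _ _).1 (hmin v hv hv0)
  · rintro ⟨hx, hxk⟩
    refine ⟨hx, ?_, fun y hy hy0 => (hiff _ _).2 (hxk ▸ h y hy hy0)⟩
    rintro rfl
    rw [inner_zero_left] at hxk
    exact hk.ne hxk

/-- Minimal vectors other than `±x` make an inner product with `x` of absolute value at most half
the minimum, since `x ± y` is not shorter. -/
theorem abs_inner_le_of_mem_minimalVectors {Λ : Submodule ℤ E} {x y : E} {k : ℝ}
    (hx : x ∈ minimalVectors Λ) (hy : y ∈ minimalVectors Λ) (hxk : ⟪x, x⟫ = k) (hyk : ⟪y, y⟫ = k)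
    (h1 : x ≠ y) (h2 : x ≠ -y) : |⟪x, y⟫| ≤ k / 2 := by
  have hle (z : E) (hz : z ∈ Λ) (hz0 : z ≠ 0) : k ≤ ⟪z, z⟫ := by
    rw [← hxk, real_inner_self_eq_norm_sq, real_inner_self_eq_norm_sq]
    exact pow_le_pow_left₀ (norm_nonneg _) (hx.2.2 z hz hz0) 2
  have e1 := hle (x - y) (Λ.sub_mem hx.1 hy.1) (sub_ne_zero.2 h1)
  have e2 := hle (x + y) (Λ.add_mem hx.1 hy.1) (fun h => h2 (add_eq_zero_iff_eq_neg.1 h))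
  rw [real_inner_sub_sub_self, hxk, hyk] at e1
  rw [real_inner_add_add_self, hxk, hyk] at e2
  rw [abs_le]
  constructor <;> linarith

end

theorem mem_span_int_iff {ι E : Type*} [Fintype ι] [AddCommGroup E] (b : ι → E) {x : E} :
    x ∈ Submodule.span ℤ (Set.range b) ↔ ∃ z : ι → ℤ, ∑ i, z i • b i = x :=
  Submodule.mem_span_range_iff_exists_fun ℤ

section
variable {ι E : Type*} [Fintype ι] [NormedAddCommGroup E] [InnerProductSpace ℝ E] {b : ι → E}

theorem inner_sum_zsmul (b : ι → E) (z w : ι → ℤ) :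
    ⟪∑ i, z i • b i, ∑ j, w j • b j⟫ = ∑ i, ∑ j, (z i : ℝ) * w j * ⟪b i, b j⟫ := by
  rw [sum_inner]
  refine Finset.sum_congr rfl fun i _ => ?_
  rw [inner_sum]
  refine Finset.sum_congr rfl fun j _ => ?_
  rw [← Int.cast_smul_eq_zsmul ℝ, ← Int.cast_smul_eq_zsmul ℝ, real_inner_smul_left,
    real_inner_smul_right]
  ring

/-- The parity of the inner product in the lattice generated by an equiangular family with cosine
`1/3`: all entries of the Gram matrix are odd. -/
theorem IsEquiangularFamily.exists_inner_eq (h : IsEquiangularFamily b 3) (z w : ι → ℤ) :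
    ∃ t : ℤ, ⟪∑ i, z i • b i, ∑ j, w j • b j⟫ = ((∑ i, z i) * ∑ j, w j + 2 * t : ℤ) := by
  have h1 (i j) : ∃ t : ℤ, ⟪b i, b j⟫ = 1 + 2 * t := by
    by_cases hij : i = j
    · subst hij
      exact ⟨1, by rw [h.inner_self]; norm_num⟩
    · rcases h.inner_ne i j hij with e | e
      · exact ⟨0, by rw [e]; norm_num⟩
      · exact ⟨-1, by rw [e]; norm_num⟩
  choose t ht using h1
  refine ⟨∑ i, ∑ j, z i * w j * t i j, ?_⟩
  rw [inner_sum_zsmul, Finset.sum_mul_sum, Finset.mul_sum]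
  simp only [Finset.mul_sum, ← Finset.sum_add_distrib]
  push_cast
  refine Finset.sum_congr rfl fun i _ => Finset.sum_congr rfl fun j _ => ?_
  rw [ht]; ring

/-- The square length modulo `4` in the lattice generated by an equiangular family with cosine
`1/3`. The off-diagonal terms count twice, hence may be replaced by those of the all-ones matrix. -/
theorem IsEquiangularFamily.exists_inner_self_eq (h : IsEquiangularFamily b 3) (z : ι → ℤ) :
    ∃ t : ℤ, ⟪∑ i, z i • b i, ∑ j, z j • b j⟫ =
      ((∑ i, z i) * (∑ i, z i + 2) + 4 * t : ℤ) := by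
  classical
  let _ : LinearOrder ι := LinearOrder.lift' (Fintype.equivFin ι) (Fintype.equivFin ι).injective
  obtain ⟨S, hS, hG⟩ := h.exists_isSeidel
  have h1 (i j) : ∃ t : ℤ, S i j + (if i = j then 1 else 0) = 1 + 2 * t ∧ (i = j → t = 0) := by
    by_cases hij : i = j
    · subst hij
      exact ⟨0, by simp [hS.diag], fun _ => rfl⟩
    · rcases hS.off i j hij with e | e
      · exact ⟨0, by simp [e, hij], fun _ => rfl⟩
      · exact ⟨-1, by simp [e, hij], fun h => absurd h hij⟩
  choose t ht ht0 using h1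
  have hsymm (i j) : t i j = t j i := by
    have e1 := ht i j
    have e2 := ht j i
    rw [hS.symm j i] at e2
    simp only [eq_comm (a := j) (b := i)] at e2
    omega
  have heven : ∃ r, ∑ i, z i * z i - ∑ i, z i = 2 * r := by
    rw [← Finset.sum_sub_distrib]
    refine (Finset.dvd_sum fun i _ => ?_ : (2 : ℤ) ∣ _)
    have := Int.even_mul_pred_self (z i)
    rw [mul_sub, mul_one] at this
    exact this.two_dvd
  obtain ⟨r, hr⟩ := heven
  have hsum := sum_eq_two_mul_sum_lt (fun i j => z i * z j * t i j)
    (fun i j => by rw [hsymm i j]; ring) (fun i => by simp [ht0 i i rfl])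
  set u := ∑ p : ι × ι with p.1 < p.2, z p.1 * z p.2 * t p.1 p.2
  refine ⟨r + u, ?_⟩
  have h2 : ⟪∑ i, z i • b i, ∑ j, z j • b j⟫ =
      ((∑ i, ∑ j, (z i * z j + 2 * (z i * z j * t i j) +
        if i = j then 2 * (z i * z j) else 0) : ℤ) : ℝ) := by
    rw [inner_sum_zsmul]
    push_cast
    refine Finset.sum_congr rfl fun i _ => Finset.sum_congr rfl fun j _ => ?_
    rw [hG]
    have e : (S i j : ℝ) + (if i = j then 1 else 0) = 1 + 2 * t i j := by exact_mod_cast ht i j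
    by_cases hij : i = j
    · simp only [hij, if_true] at e ⊢
      linear_combination ((z j : ℝ) * z j) * e
    · simp only [hij, if_false] at e ⊢
      linear_combination ((z i : ℝ) * z j) * e
  rw [h2]
  norm_cast
  simp only [Finset.sum_add_distrib, Finset.sum_ite_eq, Finset.mem_univ, if_true,
    ← Finset.mul_sum, hsum, ← Finset.sum_mul]
  linear_combination 2 * hr

theorem IsEquiangularFamily.three_le_inner_self (h : IsEquiangularFamily b 3) {x : E}
    (hx : x ∈ Submodule.span ℤ (Set.range b)) (hx0 : x ≠ 0) : 3 ≤ ⟪x, x⟫ := by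
  obtain ⟨z, rfl⟩ := (mem_span_int_iff b).1 hx
  obtain ⟨t, ht⟩ := h.exists_inner_self_eq z
  have hpos := real_inner_self_pos.2 hx0
  rw [ht] at hpos ⊢
  have hpos' : 0 < (∑ i, z i) * (∑ i, z i + 2) + 4 * t := by exact_mod_cast hpos
  have : 3 ≤ (∑ i, z i) * (∑ i, z i + 2) + 4 * t := by
    generalize ∑ i, z i = s at *
    rcases Int.even_or_odd' s with ⟨a, rfl | rfl⟩
    · have e : 2 * a * (2 * a + 2) + 4 * t = 4 * (a * (a + 1) + t) := by ring
      omega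
    · have e : (2 * a + 1) * (2 * a + 1 + 2) + 4 * t = 4 * (a * a + 2 * a + t) + 3 := by ring
      omega
  exact_mod_cast this

theorem IsEquiangularFamily.inner_eq_of_minimal (h : IsEquiangularFamily b 3) {x y : E}
    (hx : x ∈ minimalVectors (Submodule.span ℤ (Set.range b)))
    (hy : y ∈ minimalVectors (Submodule.span ℤ (Set.range b)))
    (hx3 : ⟪x, x⟫ = 3) (hy3 : ⟪y, y⟫ = 3) (h1 : x ≠ y) (h2 : x ≠ -y) :
    ⟪x, y⟫ = 1 ∨ ⟪x, y⟫ = -1 := by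
  have hle := abs_le.1 (abs_inner_le_of_mem_minimalVectors hx hy hx3 hy3 h1 h2)
  obtain ⟨z, rfl⟩ := (mem_span_int_iff b).1 hx.1
  obtain ⟨w, rfl⟩ := (mem_span_int_iff b).1 hy.1
  have hodd (u : ι → ℤ) (hu : ⟪∑ i, u i • b i, ∑ i, u i • b i⟫ = 3) : Odd (∑ i, u i) := by
    obtain ⟨t, ht⟩ := h.exists_inner_eq u u
    rw [hu] at ht
    have e : (3 : ℤ) = (∑ i, u i) * ∑ i, u i + 2 * t := by exact_mod_cast ht
    have : Odd ((∑ i, u i) * ∑ i, u i) := ⟨1 - t, by linarith⟩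
    exact (Int.odd_mul.1 this).1
  obtain ⟨t, ht⟩ := h.exists_inner_eq z w
  obtain ⟨m, hm⟩ := (hodd z hx3).mul (hodd w hy3)
  rw [ht, hm] at hle ⊢
  have e1 : (-2 : ℝ) < (2 * m + 1 + 2 * t : ℤ) := by linarith [hle.1]
  have e2 : ((2 * m + 1 + 2 * t : ℤ) : ℝ) < 2 := by linarith [hle.2]
  have e1' : -2 < 2 * m + 1 + 2 * t := by exact_mod_cast e1
  have e2' : 2 * m + 1 + 2 * t < 2 := by exact_mod_cast e2
  have : 2 * m + 1 + 2 * t = 1 ∨ 2 * m + 1 + 2 * t = -1 := by omega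
  exact_mod_cast this

/-- A basis of vectors with square length `3` and inner products `±1` generates a lattice whose
minimal vectors are its vectors of square length `3`, and these are equiangular. -/
theorem IsEquiangularFamily.isEquiangular_minimalLines [Nonempty ι]
    (h : IsEquiangularFamily b 3) :
    minimalVectors (Submodule.span ℤ (Set.range b)) =
        {x | x ∈ Submodule.span ℤ (Set.range b) ∧ ⟪x, x⟫ = 3} ∧
      IsEquiangular (minimalLines (Submodule.span ℤ (Set.range b))) := by
  have h1 := minimalVectors_eq (Λ := Submodule.span ℤ (Set.range b))
    (v := b (Classical.arbitrary ι)) (by norm_num)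
    (fun x hx => h.three_le_inner_self hx) (Submodule.subset_span (Set.mem_range_self _))
    (h.inner_self _)
  have h3 : ∀ x ∈ minimalVectors (Submodule.span ℤ (Set.range b)), ⟪x, x⟫ = 3 := by
    intro x hx
    rw [h1] at hx
    exact hx.2
  exact ⟨h1, isEquiangular_image_span zero_le_one (by norm_num) h3 fun x hx y hy hxy hxy' =>
    h.inner_eq_of_minimal hx hy (h3 x hx) (h3 y hy) hxy hxy'⟩

end

theorem sSup_minimalLines_eq_top {ι E : Type*} [NormedAddCommGroup E] [InnerProductSpace ℝ E]
    (b : Module.Basis ι ℝ E) {Λ : Submodule ℤ E} (h : ∀ i, b i ∈ minimalVectors Λ) :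
    sSup (minimalLines Λ) = ⊤ := by
  rw [eq_top_iff, ← b.span_eq, Submodule.span_le]
  rintro _ ⟨i, rfl⟩
  have hi : Submodule.span ℝ {b i} ∈ minimalLines Λ := ⟨b i, h i, rfl⟩
  exact le_sSup hi (Submodule.mem_span_singleton_self (b i))

/-- Independent vectors can be moved isometrically to any Euclidean space of the right dimension. -/
theorem exists_basis_inner_eq {ι E F : Type*} [NormedAddCommGroup E] [InnerProductSpace ℝ E]
    [NormedAddCommGroup F] [InnerProductSpace ℝ F] [Fintype ι] [FiniteDimensional ℝ E]
    {v : ι → F} (hv : LinearIndependent ℝ v) (hE : Module.finrank ℝ E = Fintype.card ι) :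
    ∃ b : Module.Basis ι ℝ E, ∀ i j, ⟪b i, b j⟫ = ⟪v i, v j⟫ := by
  set W := Submodule.span ℝ (Set.range v)
  have hW : Module.finrank ℝ W = Module.finrank ℝ E := by
    rw [hE]; exact finrank_span_eq_card hv
  have : FiniteDimensional ℝ W := FiniteDimensional.span_of_finite ℝ (Set.finite_range v)
  let φ : W ≃ₗᵢ[ℝ] E := (stdOrthonormalBasis ℝ W).equiv (stdOrthonormalBasis ℝ E) (finCongr hW)
  refine ⟨(Module.Basis.span hv).map φ.toLinearEquiv, fun i j => ?_⟩
  have e (i) : ((Module.Basis.span hv).map φ.toLinearEquiv) i =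
      φ ⟨v i, Submodule.subset_span ⟨i, rfl⟩⟩ := by
    rw [Module.Basis.map_apply]
    exact congrArg φ (Module.Basis.span_apply hv i)
  rw [e, e, φ.inner_map_map]
  rfl

/-! ### Lattices attaining the bounds -/

/-- Seven minimal vectors of the lattice of all `x ∈ ℤ⁷` reducing modulo `2` into the Hamming code,
a rescaling of the dual of `E₇`. For `n = 3, 4, 5, 6, 7` the first `n` of them generate an
`n`-dimensional section with `4`, `6`, `10`, `16`, `28` pairs of minimal vectors. -/
def hammingBasis : Matrix (Fin 7) (Fin 7) ℤ :=
  !![1, 1, 1, 0, 0, 0, 0;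
     0, 0, -1, 1, 0, 0, 1;
     1, 1, -1, 0, 0, 0, 0;
     1, 0, 0, 1, -1, 0, 0;
     0, 1, 0, 0, 1, 0, -1;
     0, 1, 0, -1, 0, -1, 0;
     0, 0, 1, 0, -1, 1, 0]

/-- Coordinates with respect to `hammingBasis` of the `28` pairs of minimal vectors. The sections of
dimension `3`, `4`, `5`, `6` contain the first `4`, `6`, `10`, `16` of them. -/
def hammingMinimal : Fin 28 → Fin 7 → ℤ :=
  ![![1, 0, 0, 0, 0, 0, 0],
    ![0, 0, 1, 0, 0, 0, 0],
    ![0, 1, 0, 0, 0, 0, 0],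
    ![-1, -1, 1, 0, 0, 0, 0],
    ![0, 0, 0, 1, 0, 0, 0],
    ![-1, -1, 0, 1, 0, 0, 0],
    ![0, 0, 0, 0, 1, 0, 0],
    ![0, 1, -1, 0, 1, 0, 0],
    ![0, 0, -1, 1, 1, 0, 0],
    ![-1, 0, 0, 1, 1, 0, 0],
    ![0, 0, 0, 0, 0, 1, 0],
    ![0, 1, -1, 0, 0, 1, 0],
    ![-1, 0, 0, 1, 0, 1, 0],
    ![0, 0, -1, 1, 0, 1, 0],
    ![-1, 0, -1, 1, 1, 1, 0],
    ![0, 1, -1, 1, 1, 1, 0],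
    ![0, 0, 0, 0, 0, 0, 1],
    ![-1, 0, 0, 0, 0, 1, 1],
    ![-1, 0, 0, 0, 1, 0, 1],
    ![0, 1, 0, -1, 0, 0, 1],
    ![0, 1, 0, 0, 1, 0, 1],
    ![0, 0, 1, -1, 0, 0, 1],
    ![0, 1, 0, 0, 0, 1, 1],
    ![-1, 0, 1, 0, 0, 0, 1],
    ![-1, 1, 0, 0, 1, 1, 1],
    ![0, 1, -1, 0, 1, 1, 1],
    ![-1, 0, 0, 1, 1, 1, 1],
    ![-1, 1, -1, 1, 1, 1, 1]]

theorem hammingBasis_gram (i j : Fin 7) :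
    (if i = j then (hammingBasis * hammingBasis.transpose) i j = 3 else
      (hammingBasis * hammingBasis.transpose) i j = 1 ∨
        (hammingBasis * hammingBasis.transpose) i j = -1) := by
  revert i j
  decide +kernel

/-- An explicit inverse of `hammingBasis`, up to the factor `2`, showing that its rows are
independent. -/
theorem hammingBasis_mul : hammingBasis *
  !![1, -1, 1, 0, -1, -1, -1;
     0, 1, 0, 0, 1, 1, 1;
     1, 0, -1, 0, 0, 0, 0;
     0, 1, -1, 1, 1, 0, 0;
     1, 0, 0, -1, 0, -1, -1;
     0, 0, 1, -1, 0, -1, 1;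
     1, 1, 0, -1, -1, 0, 0] = 2 := by
  decide +kernel

theorem hammingMinimal_ne (i j : Fin 28) (h : i ≠ j) :
    (∃ t, hammingMinimal i t ≠ hammingMinimal j t) ∧
      ∃ t, hammingMinimal i t ≠ -hammingMinimal j t := by
  revert i j
  decide +kernel

theorem hammingMinimal_gram (i : Fin 28) :
    ∑ a, ∑ c, hammingMinimal i a * hammingMinimal i c *
      (hammingBasis * hammingBasis.transpose) a c = 3 := by
  revert i
  decide +kernel

theorem exists_hammingBasis (n : ℕ) (hn : n ≤ 7) :
    ∃ b : Module.Basis (Fin n) ℝ (EuclideanSpace ℝ (Fin n)), IsEquiangularFamily b 3 ∧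
      ∀ i j, ⟪b i, b j⟫ = ((hammingBasis * hammingBasis.transpose)
        (Fin.castLE hn i) (Fin.castLE hn j) : ℤ) := by
  let v : Fin 7 → EuclideanSpace ℝ (Fin 7) := fun i =>
    WithLp.toLp 2 fun t => (hammingBasis i t : ℝ)
  have hv (i j) : ⟪v i, v j⟫ = ((hammingBasis * hammingBasis.transpose) i j : ℤ) := by
    simp only [v, PiLp.inner_apply, Matrix.mul_apply, Matrix.transpose_apply]
    push_cast
    exact Finset.sum_congr rfl fun t _ => by simp [mul_comm]
  have hli : LinearIndependent ℝ v := by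
    rw [← Matrix.det_gram_ne_zero_iff_linearIndependent]
    have h1 : Matrix.gram ℝ v =
        (Int.castRingHom ℝ).mapMatrix (hammingBasis * hammingBasis.transpose) := by
      ext i j
      rw [Matrix.gram_apply, hv]
      rfl
    have h2 : hammingBasis.det ≠ 0 := by
      intro h0
      have h3 := congrArg Matrix.det hammingBasis_mul
      rw [Matrix.det_mul, h0, zero_mul, ← Matrix.diagonal_ofNat, Matrix.det_diagonal] at h3
      simp at h3
    rw [h1, ← RingHom.map_det, Matrix.det_mul, Matrix.det_transpose]
    simpa using h2
  obtain ⟨b, hb⟩ := exists_basis_inner_eq (E := EuclideanSpace ℝ (Fin n))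
    (hli.comp _ (Fin.castLE_injective hn)) (by simp)
  refine ⟨b, ⟨fun i => ?_, fun i j hij => ?_⟩, fun i j => by rw [hb]; exact hv _ _⟩
  · rw [hb, Function.comp_apply, hv]
    have := hammingBasis_gram (Fin.castLE hn i) (Fin.castLE hn i)
    rw [if_pos rfl] at this
    exact_mod_cast this
  · rw [hb, Function.comp_apply, Function.comp_apply, hv]
    have := hammingBasis_gram (Fin.castLE hn i) (Fin.castLE hn j)
    rw [if_neg ((Fin.castLE_injective hn).ne hij)] at this
    exact_mod_cast this

/-- The section generated by the first `n` rows of `hammingBasis` contains the first `N` entries of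
`hammingMinimal`, if these do not involve the other rows. -/
theorem exists_lattice_of_hammingMinimal {n N : ℕ} (h0 : 0 < n) (hn : n ≤ 7) (hN : N ≤ 28)
    (hz : ∀ (k : Fin 28) (t : Fin 7), (k : ℕ) < N → n ≤ (t : ℕ) → hammingMinimal k t = 0) :
    ∃ Λ : Submodule ℤ (EuclideanSpace ℝ (Fin n)), IsFullLattice Λ ∧
      IsEquiangular (minimalLines Λ) ∧ sSup (minimalLines Λ) = ⊤ ∧
      (N : ℕ∞) ≤ (minimalLines Λ).encard := by
  obtain ⟨b, hb, hG⟩ := exists_hammingBasis n hn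
  have : Nonempty (Fin n) := ⟨⟨0, h0⟩⟩
  obtain ⟨hmin, heq⟩ := hb.isEquiangular_minimalLines
  refine ⟨Submodule.span ℤ (Set.range b), isFullLattice_span b, heq,
    sSup_minimalLines_eq_top b fun i => ?_, ?_⟩
  · rw [hmin]
    exact ⟨Submodule.subset_span ⟨i, rfl⟩, hb.inner_self i⟩
  have hsum (φ : Fin 7 → ℤ) (hφ : ∀ t : Fin 7, n ≤ (t : ℕ) → φ t = 0) :
      ∑ a : Fin n, φ (Fin.castLE hn a) = ∑ t, φ t := by
    refine Fintype.sum_of_injective _ (Fin.castLE_injective hn) _ _ (fun t ht => hφ t ?_)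
      fun _ => rfl
    by_contra! hlt
    exact ht ⟨⟨t, hlt⟩, rfl⟩
  have hinj (z w : Fin n → ℤ) (h : ∑ a, z a • b a = ∑ a, w a • b a) (a) : z a = w a := by
    have h1 : ∑ a, ((z a : ℝ) - w a) • b a = 0 := by
      simp only [sub_smul, Finset.sum_sub_distrib, Int.cast_smul_eq_zsmul, h, sub_self]
    have h2 := Fintype.linearIndependent_iff.1 b.linearIndependent _ h1 a
    exact_mod_cast sub_eq_zero.1 h2
  have hext {k l : Fin N} {ε : ℤ} (h : ∀ a : Fin n,
      hammingMinimal (Fin.castLE hN k) (Fin.castLE hn a) =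
        ε * hammingMinimal (Fin.castLE hN l) (Fin.castLE hn a)) (t) :
      hammingMinimal (Fin.castLE hN k) t = ε * hammingMinimal (Fin.castLE hN l) t := by
    rcases lt_or_ge (t : ℕ) n with ht | ht
    · exact h ⟨t, ht⟩
    · rw [hz _ t k.2 ht, hz _ t l.2 ht, mul_zero]
  refine le_encard_image_span (k := 3) (by norm_num) (fun x hx => ?_)
    (fun k : Fin N => ∑ a, hammingMinimal (Fin.castLE hN k) (Fin.castLE hn a) • b a)
    (fun k => ?_) (fun k l hkl => ?_)
  · rw [hmin] at hx
    exact hx.2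
  · rw [hmin]
    refine ⟨(mem_span_int_iff b).2 ⟨_, rfl⟩, ?_⟩
    rw [inner_sum_zsmul]
    simp only [hG]
    have h3 := hammingMinimal_gram (Fin.castLE hN k)
    rw [← hsum _ fun t ht => Finset.sum_eq_zero fun c _ => by rw [hz _ t k.2 ht]; ring] at h3
    have h4 (a : Fin 7) := hsum (fun c => hammingMinimal (Fin.castLE hN k) a *
      hammingMinimal (Fin.castLE hN k) c * (hammingBasis * hammingBasis.transpose) a c)
      (fun t ht => by rw [hz _ t k.2 ht]; ring)
    simp only [← h4] at h3
    exact_mod_cast h3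
  · obtain ⟨⟨t, ht⟩, ⟨u, hu⟩⟩ := hammingMinimal_ne _ _ ((Fin.castLE_injective hN).ne hkl)
    constructor
    · intro h
      exact ht (by simpa using hext (ε := 1) (fun a => by simpa using hinj _ _ h a) t)
    · intro h
      rw [← Finset.sum_neg_distrib] at h
      simp only [← neg_smul] at h
      exact hu (by simpa using hext (ε := -1) (fun a => by simpa using hinj _ _ h a) u)

theorem exists_lattice_three : ∃ Λ : Submodule ℤ (EuclideanSpace ℝ (Fin 3)), IsFullLattice Λ ∧
    IsEquiangular (minimalLines Λ) ∧ sSup (minimalLines Λ) = ⊤ ∧ 4 ≤ (minimalLines Λ).encard :=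
  exists_lattice_of_hammingMinimal (N := 4) (by norm_num) (by norm_num) (by norm_num)
    (by decide +kernel)

theorem exists_lattice_four : ∃ Λ : Submodule ℤ (EuclideanSpace ℝ (Fin 4)), IsFullLattice Λ ∧
    IsEquiangular (minimalLines Λ) ∧ sSup (minimalLines Λ) = ⊤ ∧ 6 ≤ (minimalLines Λ).encard :=
  exists_lattice_of_hammingMinimal (N := 6) (by norm_num) (by norm_num) (by norm_num)
    (by decide +kernel)

theorem exists_lattice_five : ∃ Λ : Submodule ℤ (EuclideanSpace ℝ (Fin 5)), IsFullLattice Λ ∧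
    IsEquiangular (minimalLines Λ) ∧ sSup (minimalLines Λ) = ⊤ ∧ 10 ≤ (minimalLines Λ).encard :=
  exists_lattice_of_hammingMinimal (N := 10) (by norm_num) (by norm_num) (by norm_num)
    (by decide +kernel)

theorem exists_lattice_six : ∃ Λ : Submodule ℤ (EuclideanSpace ℝ (Fin 6)), IsFullLattice Λ ∧
    IsEquiangular (minimalLines Λ) ∧ sSup (minimalLines Λ) = ⊤ ∧ 16 ≤ (minimalLines Λ).encard :=
  exists_lattice_of_hammingMinimal (N := 16) (by norm_num) (by norm_num) (by norm_num)
    (by decide +kernel)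

theorem exists_lattice_seven : ∃ Λ : Submodule ℤ (EuclideanSpace ℝ (Fin 7)), IsFullLattice Λ ∧
    IsEquiangular (minimalLines Λ) ∧ sSup (minimalLines Λ) = ⊤ ∧ 28 ≤ (minimalLines Λ).encard :=
  exists_lattice_of_hammingMinimal (N := 28) (by norm_num) (by norm_num) (by norm_num)
    (by decide +kernel)

/-- The hexagonal lattice. -/
theorem exists_lattice_two : ∃ Λ : Submodule ℤ (EuclideanSpace ℝ (Fin 2)), IsFullLattice Λ ∧
    IsEquiangular (minimalLines Λ) ∧ sSup (minimalLines Λ) = ⊤ ∧ 3 ≤ (minimalLines Λ).encard := by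
  let v : Fin 2 → EuclideanSpace ℝ (Fin 3) := ![!₂[1, -1, 0], !₂[0, 1, -1]]
  have hv : ⟪v 0, v 0⟫ = 2 ∧ ⟪v 0, v 1⟫ = -1 ∧ ⟪v 1, v 1⟫ = 2 := by
    refine ⟨?_, ?_, ?_⟩ <;> rw [PiLp.inner_apply] <;> simp [v, Fin.sum_univ_three] <;> norm_num
  have hli : LinearIndependent ℝ v := by
    rw [← Matrix.det_gram_ne_zero_iff_linearIndependent, Matrix.det_fin_two]
    simp only [Matrix.gram_apply, hv.1, hv.2.1, hv.2.2, real_inner_comm (v 0) (v 1)]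
    norm_num
  obtain ⟨b, hb⟩ := exists_basis_inner_eq (E := EuclideanSpace ℝ (Fin 2)) hli (by simp)
  set Λ := Submodule.span ℤ (Set.range b)
  have hin (z w : Fin 2 → ℤ) : ⟪∑ i, z i • b i, ∑ i, w i • b i⟫ =
      ((2 * (z 0 * w 0) - z 0 * w 1 - z 1 * w 0 + 2 * (z 1 * w 1) : ℤ) : ℝ) := by
    rw [inner_sum_zsmul]
    simp only [Fin.sum_univ_two, hb, hv.1, hv.2.1, hv.2.2, real_inner_comm (v 0) (v 1)]
    push_cast
    ring
  have hmem {x} (hx : x ∈ Λ) : ∃ z : Fin 2 → ℤ, ∑ i, z i • b i = x := (mem_span_int_iff b).1 hx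
  have hself (i) : ⟪b i, b i⟫ = 2 := by
    rw [hb]
    fin_cases i
    · exact hv.1
    · exact hv.2.2
  have hmin : minimalVectors Λ = {x | x ∈ Λ ∧ ⟪x, x⟫ = 2} := by
    refine minimalVectors_eq (v := b 0) (by norm_num) (fun x hx hx0 => ?_)
      (Submodule.subset_span ⟨0, rfl⟩) (hself 0)
    obtain ⟨z, rfl⟩ := hmem hx
    have hpos := real_inner_self_pos.2 hx0
    rw [hin] at hpos ⊢
    have h1 : 0 < 2 * (z 0 * z 0) - z 0 * z 1 - z 1 * z 0 + 2 * (z 1 * z 1) := by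
      exact_mod_cast hpos
    have h2 : 2 ≤ 2 * (z 0 * z 0) - z 0 * z 1 - z 1 * z 0 + 2 * (z 1 * z 1) := by
      rw [mul_comm (z 1) (z 0)] at h1 ⊢
      omega
    exact_mod_cast h2
  have h2 : ∀ x ∈ minimalVectors Λ, ⟪x, x⟫ = 2 := by
    intro x hx
    rw [hmin] at hx
    exact hx.2
  refine ⟨Λ, isFullLattice_span b,
    isEquiangular_image_span (k := 2) zero_le_one (by norm_num) h2 ?_,
    sSup_minimalLines_eq_top b fun i => ?_, ?_⟩
  · intro x hx y hy h1 h1'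
    have hle := abs_le.1 (abs_inner_le_of_mem_minimalVectors hx hy (h2 x hx) (h2 y hy) h1 h1')
    have hx2 := h2 x hx
    have hy2 := h2 y hy
    obtain ⟨z, rfl⟩ := hmem hx.1
    obtain ⟨w, rfl⟩ := hmem hy.1
    rw [hin] at hx2 hy2 hle ⊢
    have ez : z 0 * z 0 - z 0 * z 1 + z 1 * z 1 = 1 := by
      have : 2 * (z 0 * z 0) - z 0 * z 1 - z 1 * z 0 + 2 * (z 1 * z 1) = 2 := by
        exact_mod_cast hx2
      linarith
    have ew : w 0 * w 0 - w 0 * w 1 + w 1 * w 1 = 1 := by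
      have : 2 * (w 0 * w 0) - w 0 * w 1 - w 1 * w 0 + 2 * (w 1 * w 1) = 2 := by
        exact_mod_cast hy2
      linarith
    -- the norm form of the Eisenstein integers is multiplicative
    have hid : (2 * (z 0 * w 0) - z 0 * w 1 - z 1 * w 0 + 2 * (z 1 * w 1)) ^ 2 +
        3 * (z 0 * w 1 - z 1 * w 0) ^ 2 = 4 := by
      linear_combination 4 * (w 0 * w 0 - w 0 * w 1 + w 1 * w 1) * ez + 4 * ew
    generalize 2 * (z 0 * w 0) - z 0 * w 1 - z 1 * w 0 + 2 * (z 1 * w 1) = p at *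
    generalize z 0 * w 1 - z 1 * w 0 = d at *
    have hp1 : -1 ≤ p := by
      have : (-1 : ℝ) ≤ p := by linarith [hle.1]
      exact_mod_cast this
    have hp2 : p ≤ 1 := by
      have : (p : ℝ) ≤ 1 := by linarith [hle.2]
      exact_mod_cast this
    have hp0 : p ≠ 0 := by
      rintro rfl
      omega
    have : p = 1 ∨ p = -1 := by omega
    exact_mod_cast this
  · rw [hmin]
    exact ⟨Submodule.subset_span ⟨i, rfl⟩, hself i⟩
  · let c : Fin 3 → Fin 2 → ℤ := ![![1, 0], ![0, 1], ![1, 1]]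
    have hc : ∀ i j, 2 * (c i 0 * c j 0) - c i 0 * c j 1 - c i 1 * c j 0 + 2 * (c i 1 * c j 1) =
        if i = j then 2 else if i = 2 ∨ j = 2 then 1 else -1 := by decide
    have hself' (i) : ⟪∑ a, c i a • b a, ∑ a, c i a • b a⟫ = 2 := by
      rw [hin, hc, if_pos rfl]; norm_num
    refine le_encard_image_span (k := 2) (by norm_num) h2 (fun i => ∑ a, c i a • b a)
      (fun i => ?_) (fun i j hij => ?_)
    · rw [hmin]
      exact ⟨(mem_span_int_iff b).2 ⟨_, rfl⟩, hself' i⟩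
    · have h3 := hin (c i) (c j)
      rw [hc, if_neg hij] at h3
      constructor
      · intro h
        rw [h, hself'] at h3
        split_ifs at h3 <;> norm_num at h3
      · intro h
        rw [h, inner_neg_left, hself'] at h3
        split_ifs at h3 <;> norm_num at h3

/-! ### Tetrahedral sets -/

/-- The vectors `±p 0`, `±p 1`, `±p 2`, `±(p 0 + p 1 + p 2)`: up to signs, the vertices of a
tetrahedron centred at the origin, if the `p a` make equal obtuse angles of cosine `-1/3`. -/
def tetrahedralSet {E : Type*} [AddCommGroup E] (p : Fin 3 → E) : Set E :=
  {v | (∃ a, v = p a ∨ v = -p a) ∨ v = p 0 + p 1 + p 2 ∨ v = -(p 0 + p 1 + p 2)}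

theorem mem_tetrahedralSet_iff {E : Type*} [AddCommGroup E] {p : Fin 3 → E} {v : E} :
    v ∈ tetrahedralSet p ↔
    ∃ i : Fin 4, v = ![p 0, p 1, p 2, -(p 0 + p 1 + p 2)] i ∨
      v = -![p 0, p 1, p 2, -(p 0 + p 1 + p 2)] i := by
  simp only [tetrahedralSet, Set.mem_ofPred_eq, Fin.exists_fin_succ,
    Matrix.cons_val_zero, Matrix.cons_val_succ]
  simp
  tauto

section
variable {E : Type*} [NormedAddCommGroup E] [InnerProductSpace ℝ E]

/-- The set `S` consists of the vertices of a regular tetrahedron centred at the origin and their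
negatives. Three of the vertices determine the fourth. -/
def IsTetrahedral (S : Set E) : Prop :=
  ∃ (r : ℝ) (p : Fin 3 → E), 0 < r ∧ (∀ a b, ⟪p a, p b⟫ = if a = b then 3 * r else -r) ∧
    S = tetrahedralSet p

theorem inner_tetrahedron {p : Fin 3 → E} {r : ℝ}
    (hp : ∀ a b, ⟪p a, p b⟫ = if a = b then 3 * r else -r) (i j : Fin 4) :
    ⟪(![p 0, p 1, p 2, -(p 0 + p 1 + p 2)] : Fin 4 → E) i,
      (![p 0, p 1, p 2, -(p 0 + p 1 + p 2)] : Fin 4 → E) j⟫ = if i = j then 3 * r else -r := by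
  fin_cases i <;> fin_cases j <;>
    simp [-inner_self_eq_norm_sq_to_K, inner_add_left, inner_add_right, hp] <;> ring

theorem linearIndependent_of_tetrahedron {p : Fin 3 → E} {r : ℝ} (hr : 0 < r)
    (hp : ∀ a b, ⟪p a, p b⟫ = if a = b then 3 * r else -r) : LinearIndependent ℝ p := by
  rw [← Matrix.det_gram_ne_zero_iff_linearIndependent, Matrix.det_fin_three]
  simp only [Matrix.gram_apply, hp]
  norm_num [Fin.ext_iff]
  ring_nf
  positivity

/-- A tetrahedral set of minimal vectors defines four equiangular lines. -/
theorem IsTetrahedral.isEquiangular_and_encard {Λ : Submodule ℤ E}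
    (h : IsTetrahedral (minimalVectors Λ)) :
    IsEquiangular (minimalLines Λ) ∧ (minimalLines Λ).encard = 4 := by
  obtain ⟨r, p, hr, hp, hS⟩ := h
  set t : Fin 4 → E := ![p 0, p 1, p 2, -(p 0 + p 1 + p 2)] with ht
  have htt := inner_tetrahedron hp
  rw [← ht] at htt
  have hmem {v} : v ∈ minimalVectors Λ ↔ ∃ i, v = t i ∨ v = -t i := by
    rw [hS]; exact mem_tetrahedralSet_iff
  have h0 : ∀ v ∈ minimalVectors Λ, ⟪v, v⟫ = 3 * r := by
    intro v hv
    obtain ⟨i, rfl | rfl⟩ := hmem.1 hv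
    · rw [htt, if_pos rfl]
    · rw [inner_neg_neg, htt, if_pos rfl]
  refine ⟨isEquiangular_image_span hr.le (by linarith) h0 ?_, le_antisymm ?_ ?_⟩
  · intro v hv w hw h1 h2
    obtain ⟨i, hi⟩ := hmem.1 hv
    obtain ⟨j, hj⟩ := hmem.1 hw
    have hij : i ≠ j := by
      rintro rfl
      rcases hi with rfl | rfl <;> rcases hj with rfl | rfl <;> simp at h1 h2
    rcases hi with rfl | rfl <;> rcases hj with rfl | rfl <;>
      simp only [inner_neg_left, inner_neg_right, htt, if_neg hij, neg_neg] <;> simp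
  · have h1 : minimalLines Λ ⊆ Set.range fun i => Submodule.span ℝ {t i} := by
      rintro _ ⟨v, hv, rfl⟩
      obtain ⟨i, hi⟩ := hmem.1 hv
      exact ⟨i, (span_singleton_eq_of_eq_or_eq_neg hi).symm⟩
    refine (Set.encard_le_encard h1).trans ?_
    rw [← Set.image_univ]
    refine (Set.encard_image_le _ _).trans ?_
    simp
  · refine le_encard_image_span (N := 4) (k := 3 * r) (by positivity) h0 t
      (fun i => hmem.2 ⟨i, Or.inl rfl⟩) fun i j hij => ?_
    have h1 := htt i j
    rw [if_neg hij] at h1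
    constructor
    · intro e
      rw [e, htt, if_pos rfl] at h1
      linarith
    · intro e
      rw [e, inner_neg_left, htt, if_pos rfl] at h1
      linarith

theorem exists_linearIsometryEquiv_of_inner_eq {ι F : Type*} [Fintype ι] [NormedAddCommGroup F]
    [InnerProductSpace ℝ F] (b : Module.Basis ι ℝ E) (c : Module.Basis ι ℝ F)
    (h : ∀ i j, ⟪b i, b j⟫ = ⟪c i, c j⟫) : ∃ f : E ≃ₗᵢ[ℝ] F, ∀ i, f (b i) = c i := by
  refine ⟨(b.equiv c (Equiv.refl ι)).isometryOfInner fun x y => ?_, fun i => by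
    simp⟩
  rw [← b.sum_repr x, ← b.sum_repr y]
  simp only [map_sum, map_smul, Module.Basis.equiv_apply, Equiv.refl_apply, sum_inner, inner_sum,
    real_inner_smul_left, real_inner_smul_right, h]

theorem image_tetrahedralSet {F : Type*} [NormedAddCommGroup F] [InnerProductSpace ℝ F]
    (g : E →ₗ[ℝ] F) (p : Fin 3 → E) : g '' tetrahedralSet p = tetrahedralSet (g ∘ p) := by
  ext v
  constructor
  · rintro ⟨w, (⟨a, rfl | rfl⟩ | rfl | rfl), rfl⟩
    · exact Or.inl ⟨a, Or.inl rfl⟩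
    · exact Or.inl ⟨a, Or.inr (map_neg g _)⟩
    · exact Or.inr (Or.inl (by simp))
    · exact Or.inr (Or.inr (by rw [map_neg, map_add, map_add]; rfl))
  · rintro (⟨a, rfl | rfl⟩ | rfl | rfl)
    · exact ⟨p a, Or.inl ⟨a, Or.inl rfl⟩, rfl⟩
    · exact ⟨-p a, Or.inl ⟨a, Or.inr rfl⟩, map_neg g _⟩
    · exact ⟨p 0 + p 1 + p 2, Or.inr (Or.inl rfl), by simp⟩
    · exact ⟨-(p 0 + p 1 + p 2), Or.inr (Or.inr rfl), by
        rw [map_neg, map_add, map_add]; rfl⟩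

theorem IsTetrahedral.of_areSimilar {F : Type*} [NormedAddCommGroup F] [InnerProductSpace ℝ F]
    {S : Set E} {T : Set F} (hS : IsTetrahedral S) (h : AreSimilar S T) : IsTetrahedral T := by
  obtain ⟨r, p, hr, hp, rfl⟩ := hS
  obtain ⟨f, c, hc, rfl⟩ := h
  refine ⟨c ^ 2 * r, fun a => c • f (p a), by positivity, fun a b => ?_, ?_⟩
  · rw [real_inner_smul_left, real_inner_smul_right, f.inner_map_map, hp]
    split_ifs <;> ring
  · exact image_tetrahedralSet (c • f.toLinearEquiv.toLinearMap) p

theorem IsTetrahedral.areSimilar {F : Type*} [NormedAddCommGroup F] [InnerProductSpace ℝ F]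
    (hE : Module.finrank ℝ E = 3) (hF : Module.finrank ℝ F = 3)
    {S : Set E} {T : Set F} (hS : IsTetrahedral S) (hT : IsTetrahedral T) : AreSimilar S T := by
  obtain ⟨r, p, hr, hp, rfl⟩ := hS
  obtain ⟨s, q, hs, hq, rfl⟩ := hT
  set c := √(s / r) with hc
  have hc0 : 0 < c := Real.sqrt_pos.2 (by positivity)
  have hcc : c * c = s / r := Real.mul_self_sqrt (by positivity)
  have hli := linearIndependent_of_tetrahedron hr hp
  have hq' (a b) : ⟪c⁻¹ • q a, c⁻¹ • q b⟫ = if a = b then 3 * r else -r := by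
    have h1 : c⁻¹ * c⁻¹ = r / s := by rw [← mul_inv, hcc, inv_div]
    rw [real_inner_smul_left, real_inner_smul_right, ← mul_assoc, h1, hq]
    split_ifs <;> field_simp
  have hli' := linearIndependent_of_tetrahedron (p := fun a => c⁻¹ • q a) hr hq'
  obtain ⟨f, hf⟩ := exists_linearIsometryEquiv_of_inner_eq
    (basisOfLinearIndependentOfCardEqFinrank hli (by simp [hE]))
    (basisOfLinearIndependentOfCardEqFinrank hli' (by simp [hF])) (fun i j => by
      simp only [coe_basisOfLinearIndependentOfCardEqFinrank, hp, hq'])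
  simp only [coe_basisOfLinearIndependentOfCardEqFinrank] at hf
  refine ⟨f, c, hc0, ?_⟩
  have := image_tetrahedralSet (c • f.toLinearEquiv.toLinearMap) p
  refine this.trans (congrArg tetrahedralSet (funext fun a => ?_))
  change c • f (p a) = q a
  rw [hf, smul_inv_smul₀ hc0.ne']

end

/-! ### Lattices of dimension three with equiangular lines -/

section
variable {E : Type*} [NormedAddCommGroup E] [InnerProductSpace ℝ E]

/-- Four lattice vectors in dimension `3` satisfy an integer relation, so the inverse cosine is
rational. It is an algebraic integer, hence an integer; it is odd because the vectors are dependent,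
and the relative bound leaves `3` only. -/
theorem eq_three_of_int_relation [FiniteDimensional ℝ E] (hE : Module.finrank ℝ E = 3)
    {x : Fin 4 → E} {k : ℝ} (hk : 1 < k) (hx : IsEquiangularFamily x k) {z : Fin 4 → ℤ}
    (hz : z ≠ 0) (hzx : ∑ i, z i • x i = 0) : k = 3 := by
  obtain ⟨S, hS, hG⟩ := hx.exists_isSeidel
  have hmult := card_le_finrank_add_rootMultiplicity hG
  rw [hE, Fintype.card_fin] at hmult
  have hint := isIntegral_of_rootMultiplicity_pos (S := S) (a := -k) (by omega)
  obtain ⟨j, hj⟩ := Function.ne_iff.1 hz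
  have hj' : (z j : ℝ) ≠ 0 := by exact_mod_cast hj
  have h1 : k * z j + ∑ i, (z i : ℝ) * S j i = 0 := by
    have h2 : ⟪x j, ∑ i, z i • x i⟫ = 0 := by rw [hzx, inner_zero_right]
    rw [inner_sum] at h2
    simp only [← Int.cast_smul_eq_zsmul ℝ, real_inner_smul_right, hG, mul_add,
      Finset.sum_add_distrib, mul_ite, mul_zero, Finset.sum_ite_eq, Finset.mem_univ, if_true] at h2
    linarith
  have hq : -k = ((∑ i, (z i : ℚ) * S j i) / z j : ℚ) := by
    push_cast
    rw [eq_div_iff hj']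
    linarith
  rw [hq, ← eq_ratCast (algebraMap ℚ ℝ),
    isIntegral_algebraMap_iff (FaithfulSMul.algebraMap_injective ℚ ℝ)] at hint
  obtain ⟨m, hm⟩ := IsIntegrallyClosed.isIntegral_iff.1 hint
  rw [← hm] at hq
  obtain ⟨l, rfl⟩ : ∃ l : ℤ, k = l := ⟨-m, by push_cast at hq ⊢; simp at hq; linarith⟩
  have h1l : (1 : ℤ) < l := by exact_mod_cast hk
  have hodd : Odd l := by
    rw [← Int.not_even_iff_odd]
    intro he
    have := (hx.linearIndependent_of_even he (by decide)).fintype_card_le_finrank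
    rw [hE, Fintype.card_fin] at this
    omega
  have hb := hx.relative_bound hk
  rw [hE, Fintype.card_fin] at hb
  push_cast at hb
  have hb' : l ^ 2 ≤ 9 := by
    have : (l : ℝ) ^ 2 ≤ 9 := by linarith
    exact_mod_cast this
  have hl3 : l ≤ 3 := by
    by_contra! h
    clear * - h hb'
    nlinarith
  obtain ⟨r, hr⟩ := hodd
  have : l = 3 := by omega
  rw [this]; norm_num

theorem exists_int_relation [FiniteDimensional ℝ E] {Λ : Submodule ℤ E} (hΛ : IsFullLattice Λ)
    {ι : Type*} [Fintype ι] {x : ι → E} (hx : ∀ i, x i ∈ Λ)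
    (hι : Module.finrank ℝ E < Fintype.card ι) :
    ∃ z : ι → ℤ, z ≠ 0 ∧ ∑ i, z i • x i = 0 := by
  obtain ⟨hd, hl⟩ := hΛ
  have hfin : Module.Finite ℤ Λ := ZLattice.module_finite ℝ Λ
  have hfree : Module.Free ℤ Λ := ZLattice.module_free ℝ Λ
  have hdep : ¬ LinearIndependent ℤ fun i => (⟨x i, hx i⟩ : Λ) := by
    intro h
    have := h.fintype_card_le_finrank
    rw [ZLattice.rank ℝ Λ] at this
    omega
  rw [Fintype.not_linearIndependent_iff] at hdep
  obtain ⟨z, hz, i, hi⟩ := hdep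
  refine ⟨z, fun h => hi (by rw [h]; rfl), ?_⟩
  have := congrArg (Subtype.val : Λ → E) hz
  simpa using this

theorem inner_self_eq_of_mem_minimalVectors {Λ : Submodule ℤ E} {v w : E}
    (hv : v ∈ minimalVectors Λ) (hw : w ∈ minimalVectors Λ) : ⟪v, v⟫ = ⟪w, w⟫ := by
  rw [real_inner_self_eq_norm_sq, real_inner_self_eq_norm_sq,
    le_antisymm (hv.2.2 w hw.1 hw.2.1) (hw.2.2 v hv.1 hv.2.1)]

theorem mem_minimalVectors_of_inner_self_eq {Λ : Submodule ℤ E} {v w : E}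
    (hv : v ∈ minimalVectors Λ) (hw : w ∈ Λ) (h : ⟪w, w⟫ = ⟪v, v⟫) : w ∈ minimalVectors Λ := by
  have hn : ‖w‖ = ‖v‖ := by
    rw [real_inner_self_eq_norm_sq, real_inner_self_eq_norm_sq] at h
    exact (pow_left_inj₀ (norm_nonneg _) (norm_nonneg _) two_ne_zero).1 h
  refine ⟨hw, ?_, fun y hy hy0 => hn ▸ hv.2.2 y hy hy0⟩
  rw [← norm_ne_zero_iff, hn, norm_ne_zero_iff]
  exact hv.2.1

theorem exists_inner_eq_of_isEquiangular_minimalLines {Λ : Submodule ℤ E} {v₀ : E}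
    (hv₀ : v₀ ∈ minimalVectors Λ) (hX : IsEquiangular (minimalLines Λ)) :
    ∃ r : ℝ, 0 ≤ r ∧ ∀ v ∈ minimalVectors Λ, ∀ w ∈ minimalVectors Λ, v ≠ w → v ≠ -w →
      ⟪v, w⟫ = r ∨ ⟪v, w⟫ = -r := by
  obtain ⟨-, θ, hθ, hang⟩ := hX
  have hα0 : 0 ≤ Real.cos θ :=
    Real.cos_nonneg_of_mem_Icc ⟨by linarith [hθ.1, Real.pi_pos], hθ.2⟩
  have hnorm {v} (hv : v ∈ minimalVectors Λ) : ‖v‖ = ‖v₀‖ :=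
    le_antisymm (hv.2.2 v₀ hv₀.1 hv₀.2.1) (hv₀.2.2 v hv.1 hv.2.1)
  refine ⟨‖v₀‖ * ‖v₀‖ * Real.cos θ, by positivity, fun v hv w hw h1 h2 => ?_⟩
  rw [← abs_eq (by positivity), hang _ ⟨v, hv, rfl⟩ _ ⟨w, hw, rfl⟩ (fun h => ?_) v
    (Submodule.mem_span_singleton_self v) w (Submodule.mem_span_singleton_self w), hnorm hv,
    hnorm hw]
  have h0 : ⟪v₀, v₀⟫ ≠ 0 := (real_inner_self_pos.2 hv₀.2.1).ne'
  rcases eq_or_eq_neg_of_span_singleton_eq h0 (inner_self_eq_of_mem_minimalVectors hv hv₀)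
    (inner_self_eq_of_mem_minimalVectors hw hv₀) h with e | e
  · exact h1 e
  · exact h2 e

/-- In dimension `3` a vector is determined by its inner products with the vertices of a
tetrahedron, which form a tight frame. If they all are `±r`, Parseval's identity gives its square
length. -/
theorem inner_self_eq_of_tetrahedron (hE : Module.finrank ℝ E = 3) {p : Fin 3 → E} {r : ℝ}
    (hr : 0 < r) (hp : ∀ a b, ⟪p a, p b⟫ = if a = b then 3 * r else -r) {v : E}
    (h : ∀ a, ⟪v, p a⟫ = r ∨ ⟪v, p a⟫ = -r)
    (hq : ⟪v, -(p 0 + p 1 + p 2)⟫ = r ∨ ⟪v, -(p 0 + p 1 + p 2)⟫ = -r) : ⟪v, v⟫ = r := by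
  set b := basisOfLinearIndependentOfCardEqFinrank (linearIndependent_of_tetrahedron hr hp)
    (by simp [hE])
  have hb (a) : b a = p a := by simp [b]
  set q := -(p 0 + p 1 + p 2) with hqdef
  have hw : v = (4 * r)⁻¹ • (⟪v, p 0⟫ • p 0 + ⟪v, p 1⟫ • p 1 + ⟪v, p 2⟫ • p 2 + ⟪v, q⟫ • q) := by
    refine InnerProductSpace.ext_inner_left_basis (𝕜 := ℝ) b fun a => ?_
    have h1 : ⟪v, q⟫ = -(⟪v, p 0⟫ + ⟪v, p 1⟫ + ⟪v, p 2⟫) := by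
      rw [hqdef, inner_neg_right, inner_add_right, inner_add_right]
    rw [hb, h1, hqdef, real_inner_comm]
    simp only [real_inner_smul_right, inner_add_right, inner_neg_right, hp]
    obtain rfl | rfl | rfl : a = 0 ∨ a = 1 ∨ a = 2 := by fin_cases a <;> simp
    all_goals
      norm_num [Fin.ext_iff]
      field_simp
      ring
  have hsq (u) (hu : ⟪v, u⟫ = r ∨ ⟪v, u⟫ = -r) : ⟪v, u⟫ * ⟪v, u⟫ = r * r := by
    rcases hu with e | e <;> rw [e]
    ring
  have h2 := congrArg (fun u => ⟪v, u⟫) hw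
  simp only [real_inner_smul_right, inner_add_right, hsq _ (h _), hsq _ hq] at h2
  rw [h2]
  field_simp
  ring

/-- A lattice of dimension `3` with at least four lines, which are equiangular, has tetrahedral
minimal vectors: three of them determine a fourth, being the negative of their sum, and no further
line is at the same angle to all four. -/
theorem isTetrahedral_of_four_le [FiniteDimensional ℝ E] (hE : Module.finrank ℝ E = 3)
    {Λ : Submodule ℤ E} (hΛ : IsFullLattice Λ) (hX : IsEquiangular (minimalLines Λ))
    (h4 : 4 ≤ (minimalLines Λ).encard) : IsTetrahedral (minimalVectors Λ) := by
  obtain ⟨e, he, heX, -⟩ := exists_injective_of_le_encard (N := 4) h4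
  choose m hm hme using heX
  obtain ⟨r, hr0, hr⟩ := exists_inner_eq_of_isEquiangular_minimalLines (hm 0) hX
  have hself {v} (hv : v ∈ minimalVectors Λ) : ⟪v, v⟫ = ⟪m 0, m 0⟫ :=
    inner_self_eq_of_mem_minimalVectors hv (hm 0)
  set ρ := ⟪m 0, m 0⟫ with hρ
  have hρ0 : 0 < ρ := real_inner_self_pos.2 (hm 0).2.1
  have hmne (i j) (hij : i ≠ j) : m i ≠ m j ∧ m i ≠ -m j := by
    have h1 : ¬ (m i = m j ∨ m i = -m j) := fun h => hij (he (by
      rw [← hme i, ← hme j]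
      exact span_singleton_eq_of_eq_or_eq_neg h))
    tauto
  have hmm (i j) (hij : i ≠ j) : ⟪m i, m j⟫ = r ∨ ⟪m i, m j⟫ = -r :=
    hr _ (hm i) _ (hm j) (hmne i j hij).1 (hmne i j hij).2
  have hrpos : 0 < r := by
    refine hr0.lt_of_ne fun h0 => ?_
    have := card_le_finrank_of_orthogonal (x := m) (fun i => (hm i).2.1) fun i j hij => by
      have := hmm i j hij
      rw [← h0] at this
      simpa using this
    rw [hE, Fintype.card_fin] at this
    omega
  have hrρ : r < ρ := by
    have h1 := abs_inner_le_of_mem_minimalVectors (hm 0) (hm 1) rfl (hself (hm 1))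
      (hmne 0 1 (by decide)).1 (hmne 0 1 (by decide)).2
    rw [(abs_eq hr0).2 (hmm 0 1 (by decide)), ← hρ] at h1
    linarith
  -- scaling makes the inner products `±1`
  set c := √r⁻¹ with hc
  have hcc : c * c = r⁻¹ := Real.mul_self_sqrt (inv_nonneg.2 hr0)
  have hin (v w : E) : ⟪c • v, c • w⟫ = r⁻¹ * ⟪v, w⟫ := by
    rw [real_inner_smul_left, real_inner_smul_right, ← mul_assoc, hcc]
  have hfam : IsEquiangularFamily (fun i => c • m i) (r⁻¹ * ρ) := by
    refine ⟨fun i => by rw [hin, hself (hm i)], fun i j hij => ?_⟩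
    rw [hin]
    rcases hmm i j hij with e | e <;> rw [e]
    · exact Or.inl (inv_mul_cancel₀ hrpos.ne')
    · exact Or.inr (by rw [mul_neg, inv_mul_cancel₀ hrpos.ne'])
  have hk : 1 < r⁻¹ * ρ := by
    rw [inv_mul_eq_div]
    exact (one_lt_div hrpos).2 hrρ
  obtain ⟨z, hz, hzm⟩ := exists_int_relation hΛ (fun i => (hm i).1) (by rw [hE]; decide)
  have h3 := eq_three_of_int_relation hE hk hfam hz (by
    have : ∑ i, z i • (c • m i) = c • ∑ i, z i • m i := by
      rw [Finset.smul_sum]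
      exact Finset.sum_congr rfl fun i _ => smul_comm _ _ _
    rw [this, hzm, smul_zero])
  have hρr : ρ = 3 * r := by
    rw [inv_mul_eq_div, div_eq_iff hrpos.ne'] at h3
    exact h3
  obtain ⟨f, ε, hf, hε, hneg⟩ := hfam.exists_triple hk fun hli => by
    have := hli.fintype_card_le_finrank
    rw [hE, Fintype.card_fin] at this
    omega
  set p : Fin 3 → E := fun a => ε a • m (f a) with hpdef
  have hpm (a) : p a = m (f a) ∨ p a = -m (f a) := by
    rcases hε a with e | e <;> simp [hpdef, e]
  have hpS (a) : p a ∈ minimalVectors Λ := by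
    rcases hpm a with e | e <;> rw [e]
    · exact hm _
    · exact mem_minimalVectors_of_inner_self_eq (hm (f a)) (Λ.neg_mem (hm _).1) (inner_neg_neg _ _)
  have hp (a b) : ⟪p a, p b⟫ = if a = b then 3 * r else -r := by
    by_cases hab : a = b
    · subst hab
      rw [hself (hpS a), if_pos rfl, hρr]
    · have h5 := hneg a b hab
      rw [smul_comm, smul_comm (ε b), hin, inv_mul_eq_div, div_eq_iff hrpos.ne'] at h5
      rw [if_neg hab, h5]
      ring
  set q := -(p 0 + p 1 + p 2) with hq
  have hqq : ⟪q, q⟫ = 3 * r := by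
    have := inner_tetrahedron hp 3 3
    rwa [if_pos rfl] at this
  have hqS : q ∈ minimalVectors Λ :=
    mem_minimalVectors_of_inner_self_eq (hm 0)
      (Λ.neg_mem (Λ.add_mem (Λ.add_mem (hpS 0).1 (hpS 1).1) (hpS 2).1)) (by rw [hqq, ← hρ, hρr])
  refine ⟨r, p, hrpos, hp, Set.Subset.antisymm (fun v hv => ?_) ?_⟩
  · by_contra hnot
    simp only [tetrahedralSet, Set.mem_ofPred_eq, not_or, not_exists] at hnot
    have h6 := inner_self_eq_of_tetrahedron hE hrpos hp
      (fun a => hr v hv _ (hpS a) (hnot.1 a).1 (hnot.1 a).2)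
      (hr v hv _ hqS hnot.2.2 (by rw [neg_neg]; exact hnot.2.1))
    rw [hself hv] at h6
    linarith
  · have hnegS {v} (hv : v ∈ minimalVectors Λ) : -v ∈ minimalVectors Λ :=
      mem_minimalVectors_of_inner_self_eq hv (Λ.neg_mem hv.1) (inner_neg_neg _ _)
    rintro v (⟨a, rfl | rfl⟩ | rfl | rfl)
    · exact hpS a
    · exact hnegS (hpS a)
    · have := hnegS hqS
      rwa [hq, neg_neg] at this
    · exact hqS

end

/-! ### The dual of the root lattice and the icosahedron -/

theorem inner_sumZeroSpace {n : ℕ} (x y : sumZeroSpace n) :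
    ⟪x, y⟫ =
      ∑ i, (x : EuclideanSpace ℝ (Fin (n + 1))) i * (y : EuclideanSpace ℝ (Fin (n + 1))) i := by
  rw [Submodule.coe_inner, PiLp.inner_apply]
  exact Finset.sum_congr rfl fun i _ => by simp [mul_comm]

theorem sum_coe_sumZeroSpace {n : ℕ} (x : sumZeroSpace n) :
    ∑ i, (x : EuclideanSpace ℝ (Fin (n + 1))) i = 0 := x.2

theorem finrank_sumZeroSpace (n : ℕ) : Module.finrank ℝ (sumZeroSpace n) = n := by
  have h1 : sumZeroSpace n = (Submodule.span ℝ
      {(WithLp.toLp 2 fun _ => 1 : EuclideanSpace ℝ (Fin (n + 1)))})ᗮ := by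
    ext x
    rw [Submodule.mem_orthogonal_singleton_iff_inner_right, PiLp.inner_apply]
    simp [sumZeroSpace]
  rw [h1]
  have h2 := Submodule.finrank_add_finrank_orthogonal (Submodule.span ℝ
      {(WithLp.toLp 2 fun _ => 1 : EuclideanSpace ℝ (Fin (n + 1)))})
  rw [finrank_span_singleton, finrank_euclideanSpace_fin] at h2
  · exact Nat.add_left_cancel (h2.trans (Nat.add_comm n 1))
  · intro h
    simpa using congrArg (fun v : EuclideanSpace ℝ (Fin (n + 1)) => v 0) h

/-- The projection of the `a`-th unit vector to the space of vectors with sum zero. -/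
noncomputable def unitProjection (a : Fin 4) : sumZeroSpace 3 :=
  ⟨WithLp.toLp 2 fun i => (if i = a then 1 else 0) - 1 / 4, by
    simp [sumZeroSpace, Finset.sum_sub_distrib]⟩

theorem unitProjection_apply (a i : Fin 4) :
    (unitProjection a : EuclideanSpace ℝ (Fin 4)) i = (if i = a then 1 else 0) - 1 / 4 := rfl

theorem inner_unitProjection_left (a : Fin 4) (x : sumZeroSpace 3) :
    ⟪unitProjection a, x⟫ = (x : EuclideanSpace ℝ (Fin 4)) a := by
  rw [inner_sumZeroSpace]
  simp only [unitProjection_apply, sub_mul, Finset.sum_sub_distrib, ← Finset.mul_sum,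
    sum_coe_sumZeroSpace]
  simp

theorem unitProjection_mem (a : Fin 4) : unitProjection a ∈ dualLattice (rootLatticeA 3) := by
  intro y hy
  rw [inner_unitProjection_left]
  exact hy a

/-- The coordinates of a vector in the dual of `A₃` are congruent modulo `1`. -/
theorem exists_sub_eq_intCast {x : sumZeroSpace 3} (hx : x ∈ dualLattice (rootLatticeA 3))
    (i : Fin 4) :
    ∃ d : ℤ, (x : EuclideanSpace ℝ (Fin 4)) i - (x : EuclideanSpace ℝ (Fin 4)) 0 = d := by
  have hmem : unitProjection i - unitProjection 0 ∈ rootLatticeA 3 := by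
    intro j
    refine ⟨(if j = i then 1 else 0) - if j = 0 then 1 else 0, ?_⟩
    rw [Submodule.coe_sub, PiLp.sub_apply, unitProjection_apply, unitProjection_apply]
    push_cast
    ring
  obtain ⟨k, hk⟩ := hx _ hmem
  refine ⟨k, ?_⟩
  rw [← hk, real_inner_comm, inner_sub_left, inner_unitProjection_left, inner_unitProjection_left]

theorem inner_self_combination {E : Type*} [NormedAddCommGroup E] [InnerProductSpace ℝ E]
    {p : Fin 3 → E} {r : ℝ} (hp : ∀ a b, ⟪p a, p b⟫ = if a = b then 3 * r else -r) (a b c : ℝ) :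
    ⟪a • p 0 + b • p 1 + c • p 2, a • p 0 + b • p 1 + c • p 2⟫ =
      r * (a ^ 2 + b ^ 2 + c ^ 2 + (a - b) ^ 2 + (a - c) ^ 2 + (b - c) ^ 2) := by
  simp only [inner_add_left, inner_add_right, real_inner_smul_left, real_inner_smul_right, hp]
  norm_num [Fin.ext_iff]
  ring

/-- The integer vectors at which the quadratic form of the dual of `A₃`, scaled by `4`, is at most
`3`: zero, and eight vectors where it equals `3`. -/
theorem int_form_cases (a b c : ℤ)
    (h : a ^ 2 + b ^ 2 + c ^ 2 + (a - b) ^ 2 + (a - c) ^ 2 + (b - c) ^ 2 ≤ 3) :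
    (a = 0 ∧ b = 0 ∧ c = 0) ∨
    a ^ 2 + b ^ 2 + c ^ 2 + (a - b) ^ 2 + (a - c) ^ 2 + (b - c) ^ 2 = 3 ∧
    ((a = 1 ∧ b = 0 ∧ c = 0) ∨ (a = -1 ∧ b = 0 ∧ c = 0) ∨
    (a = 0 ∧ b = 1 ∧ c = 0) ∨ (a = 0 ∧ b = -1 ∧ c = 0) ∨ (a = 0 ∧ b = 0 ∧ c = 1) ∨
    (a = 0 ∧ b = 0 ∧ c = -1) ∨ (a = 1 ∧ b = 1 ∧ c = 1) ∨ (a = -1 ∧ b = -1 ∧ c = -1)) := by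
  have ha : -1 ≤ a ∧ a ≤ 1 := by
    constructor <;> nlinarith [sq_nonneg b, sq_nonneg c, sq_nonneg (a - b),
      sq_nonneg (a - c), sq_nonneg (b - c)]
  have hb : -1 ≤ b ∧ b ≤ 1 := by
    constructor <;> nlinarith [sq_nonneg a, sq_nonneg c, sq_nonneg (a - b),
      sq_nonneg (a - c), sq_nonneg (b - c)]
  have hc : -1 ≤ c ∧ c ≤ 1 := by
    constructor <;> nlinarith [sq_nonneg b, sq_nonneg a, sq_nonneg (a - b),
      sq_nonneg (a - c), sq_nonneg (b - c)]
  obtain ⟨ha1, ha2⟩ := ha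
  obtain ⟨hb1, hb2⟩ := hb
  obtain ⟨hc1, hc2⟩ := hc
  interval_cases a <;> interval_cases b <;> interval_cases c <;> simp at h ⊢

/-- The minimal vectors of the dual of `A₃` are the projections of the unit vectors and their
negatives. In terms of the integers `d i = x i - x 0` four times the square length is
`∑ i < j, (d i - d j) ^ 2`. -/
theorem isTetrahedral_dual_rootLatticeA :
    IsTetrahedral (minimalVectors (dualLattice (rootLatticeA 3))) := by
  set p : Fin 3 → sumZeroSpace 3 := fun a => unitProjection a.succ with hp
  have hin (a b) : ⟪p a, p b⟫ = if a = b then 3 * (1 / 4) else -(1 / 4) := by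
    rw [hp, inner_unitProjection_left, unitProjection_apply]
    simp only [Fin.succ_inj]
    split_ifs <;> norm_num
  have hpmem (a) : p a ∈ dualLattice (rootLatticeA 3) := unitProjection_mem _
  have hneg : p 0 + p 1 + p 2 = -unitProjection 0 := by
    ext i
    rw [Submodule.coe_add, Submodule.coe_add, Submodule.coe_neg, PiLp.add_apply, PiLp.add_apply,
      PiLp.neg_apply]
    simp only [hp, unitProjection_apply]
    fin_cases i <;> norm_num [Fin.ext_iff]
  -- a vector is determined by the differences of its coordinates
  have hcoord (x : sumZeroSpace 3) {d : Fin 4 → ℤ}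
      (hd : ∀ i, (x : EuclideanSpace ℝ (Fin 4)) i - (x : EuclideanSpace ℝ (Fin 4)) 0 = d i) :
      x = (d 1 : ℝ) • p 0 + (d 2 : ℝ) • p 1 + (d 3 : ℝ) • p 2 := by
    have hs := sum_coe_sumZeroSpace x
    rw [Fin.sum_univ_four] at hs
    have h1 := hd 1
    have h2 := hd 2
    have h3 := hd 3
    ext i
    rw [Submodule.coe_add, Submodule.coe_add, PiLp.add_apply, PiLp.add_apply, Submodule.coe_smul,
      Submodule.coe_smul, Submodule.coe_smul, PiLp.smul_apply, PiLp.smul_apply, PiLp.smul_apply]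
    simp only [hp, unitProjection_apply, smul_eq_mul]
    obtain rfl | rfl | rfl | rfl : i = 0 ∨ i = 1 ∨ i = 2 ∨ i = 3 := by fin_cases i <;> simp
    all_goals
      norm_num [Fin.ext_iff]
      linarith
  have hform (x : sumZeroSpace 3) {d : Fin 4 → ℤ}
      (hd : ∀ i, (x : EuclideanSpace ℝ (Fin 4)) i - (x : EuclideanSpace ℝ (Fin 4)) 0 = d i) :
      ((d 1 ^ 2 + d 2 ^ 2 + d 3 ^ 2 + (d 1 - d 2) ^ 2 + (d 1 - d 3) ^ 2 + (d 2 - d 3) ^ 2 : ℤ) : ℝ)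
        = 4 * ⟪x, x⟫ := by
    have hx := hcoord x hd
    rw [hx, inner_self_combination hin]
    push_cast
    ring
  have hmin : minimalVectors (dualLattice (rootLatticeA 3)) =
      {x | x ∈ dualLattice (rootLatticeA 3) ∧ ⟪x, x⟫ = 3 / 4} := by
    refine minimalVectors_eq (v := p 0) (by norm_num) (fun x hx hx0 => ?_) (hpmem 0)
      (by rw [hin, if_pos rfl]; norm_num)
    choose d hd using exists_sub_eq_intCast hx
    by_contra! hlt
    have hf := hform x hd
    have hle : d 1 ^ 2 + d 2 ^ 2 + d 3 ^ 2 + (d 1 - d 2) ^ 2 + (d 1 - d 3) ^ 2 +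
        (d 2 - d 3) ^ 2 < 3 := by
      have : ((d 1 ^ 2 + d 2 ^ 2 + d 3 ^ 2 + (d 1 - d 2) ^ 2 + (d 1 - d 3) ^ 2 +
        (d 2 - d 3) ^ 2 : ℤ) : ℝ) < (3 : ℤ) := by
        rw [hf]; push_cast; linarith
      exact_mod_cast this
    rcases int_form_cases _ _ _ hle.le with ⟨h1, h2, h3⟩ | ⟨h, -⟩
    · exact hx0 (by rw [hcoord x hd, h1, h2, h3]; simp)
    · omega
  refine ⟨1 / 4, p, by norm_num, hin, ?_⟩
  rw [hmin]
  refine Set.Subset.antisymm ?_ ?_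
  · rintro x ⟨hx, hxx⟩
    choose d hd using exists_sub_eq_intCast hx
    have hf := hform x hd
    rw [hxx] at hf
    have hf3 : d 1 ^ 2 + d 2 ^ 2 + d 3 ^ 2 + (d 1 - d 2) ^ 2 + (d 1 - d 3) ^ 2 +
        (d 2 - d 3) ^ 2 = 3 := by
      have : ((d 1 ^ 2 + d 2 ^ 2 + d 3 ^ 2 + (d 1 - d 2) ^ 2 + (d 1 - d 3) ^ 2 +
        (d 2 - d 3) ^ 2 : ℤ) : ℝ) = (3 : ℤ) := by
        rw [hf]; push_cast; norm_num
      exact_mod_cast this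
    have hx' := hcoord x hd
    rcases int_form_cases _ _ _ hf3.le with ⟨h1, h2, h3⟩ | ⟨-, h⟩
    · rw [h1, h2, h3] at hf3
      norm_num at hf3
    · rcases h with ⟨h1, h2, h3⟩ | ⟨h1, h2, h3⟩ | ⟨h1, h2, h3⟩ | ⟨h1, h2, h3⟩ | ⟨h1, h2, h3⟩ |
        ⟨h1, h2, h3⟩ | ⟨h1, h2, h3⟩ | ⟨h1, h2, h3⟩ <;> rw [h1, h2, h3] at hx'
      · exact Or.inl ⟨0, Or.inl (by rw [hx']; simp)⟩
      · exact Or.inl ⟨0, Or.inr (by rw [hx']; simp)⟩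
      · exact Or.inl ⟨1, Or.inl (by rw [hx']; simp)⟩
      · exact Or.inl ⟨1, Or.inr (by rw [hx']; simp)⟩
      · exact Or.inl ⟨2, Or.inl (by rw [hx']; simp)⟩
      · exact Or.inl ⟨2, Or.inr (by rw [hx']; simp)⟩
      · exact Or.inr (Or.inl (by rw [hx']; simp))
      · exact Or.inr (Or.inr (by rw [hx']; simp; abel))
  · have hmem0 := unitProjection_mem 0
    have h0 : ⟪unitProjection 0, unitProjection 0⟫ = 3 / 4 := by
      rw [inner_unitProjection_left, unitProjection_apply, if_pos rfl]; norm_num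
    rintro v (⟨a, rfl | rfl⟩ | rfl | rfl)
    · exact ⟨hpmem a, by rw [hin, if_pos rfl]; norm_num⟩
    · exact ⟨Submodule.neg_mem _ (hpmem a), by rw [inner_neg_neg, hin, if_pos rfl]; norm_num⟩
    · rw [hneg]
      exact ⟨Submodule.neg_mem _ hmem0, by rw [inner_neg_neg, h0]⟩
    · rw [hneg, neg_neg]
      exact ⟨hmem0, h0⟩

/-- The six diagonals of the icosahedron, whose vertices are the cyclic permutations of
`(0, ±1, ±φ)`, are equiangular. -/
theorem six_le_maxSpanningEquiangular_three : 6 ≤ maxSpanningEquiangular 3 := by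
  set φ := Real.goldenRatio with hφ
  have hφ2 : φ ^ 2 = φ + 1 := Real.goldenRatio_sq
  have hφ1 : 1 < φ := Real.one_lt_goldenRatio
  let u : Fin 6 → EuclideanSpace ℝ (Fin 3) :=
    ![!₂[0, 1, φ], !₂[0, 1, -φ], !₂[1, φ, 0], !₂[1, -φ, 0], !₂[φ, 0, 1], !₂[-φ, 0, 1]]
  have hself (i) : ⟪u i, u i⟫ = φ + 2 := by
    rw [PiLp.inner_apply]
    fin_cases i <;> simp [u, Fin.sum_univ_three] <;> linarith
  have hne (i j) (hij : i ≠ j) : ⟪u i, u j⟫ = φ ∨ ⟪u i, u j⟫ = -φ := by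
    have hφφ : φ * φ = φ + 1 := by rw [← sq, hφ2]
    rw [PiLp.inner_apply]
    fin_cases i <;> fin_cases j <;> first
      | exact absurd rfl hij
      | (simp [u, Fin.sum_univ_three]; done)
      | (simp [u, Fin.sum_univ_three]; right; linarith)
  have h0 : ∀ x ∈ Set.range u, ⟪x, x⟫ = φ + 2 := by
    rintro _ ⟨i, rfl⟩
    exact hself i
  have hX := isEquiangular_image_span (s := Set.range u) (k := φ + 2) (r := φ) (by linarith)
    (by linarith) h0 (by
      rintro _ ⟨i, rfl⟩ _ ⟨j, rfl⟩ h1 -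
      exact hne i j fun h => h1 (by rw [h]))
  have hcard := le_encard_image_span (s := Set.range u) (by linarith : φ + 2 ≠ 0) h0 u
    (fun i => ⟨i, rfl⟩) fun i j hij => by
      have h1 := hne i j hij
      constructor
      · intro e
        rw [e, hself] at h1
        rcases h1 with h | h <;> linarith
      · intro e
        rw [e, inner_neg_left, hself] at h1
        rcases h1 with h | h <;> linarith
  refine hcard.trans (hX.encard_le_maxSpanningEquiangular ?_)
  rw [← Submodule.orthogonal_eq_bot_iff, Submodule.eq_bot_iff]
  intro w hw
  have hw' (i) : ⟪u i, w⟫ = 0 := by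
    refine hw (u i) ?_
    have hi : Submodule.span ℝ {u i} ∈ (fun x => Submodule.span ℝ {x}) '' Set.range u :=
      ⟨u i, ⟨i, rfl⟩, rfl⟩
    exact le_sSup hi (Submodule.mem_span_singleton_self (u i))
  have e0 := hw' 0
  have e1 := hw' 1
  have e2 := hw' 2
  have e3 := hw' 3
  rw [PiLp.inner_apply] at e0 e1 e2 e3
  simp [u, Fin.sum_univ_three] at e0 e1 e2 e3
  have h1 : w 1 = 0 := by linarith
  have h2 : w 0 = 0 := by linarith
  have h3 : w 2 = 0 := by
    have : w 2 * φ = 0 := by linarith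
    exact (mul_eq_zero.1 this).resolve_right (by linarith)
  ext i
  fin_cases i
  · exact h2
  · exact h1
  · exact h3

/-! ### The maximal cardinalities -/

/-- A lattice whose lines attain an upper bound for equiangular sets of lines determines both
maximal cardinalities. -/
theorem maxSpanningEquiangular_eq_of_lattice {n N : ℕ} (hle : maxEquiangular n ≤ N)
    (h : ∃ Λ : Submodule ℤ (EuclideanSpace ℝ (Fin n)), IsFullLattice Λ ∧
      IsEquiangular (minimalLines Λ) ∧ sSup (minimalLines Λ) = ⊤ ∧
      (N : ℕ∞) ≤ (minimalLines Λ).encard) :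
    maxSpanningEquiangular n = maxEquiangular n ∧
      ∃ Λ : Submodule ℤ (EuclideanSpace ℝ (Fin n)), IsFullLattice Λ ∧
        IsEquiangular (minimalLines Λ) ∧ sSup (minimalLines Λ) = ⊤ ∧
        (minimalLines Λ).encard = maxSpanningEquiangular n := by
  obtain ⟨Λ, hΛ, hX, hs, hN⟩ := h
  have h1 := hX.encard_le_maxSpanningEquiangular hs
  have h2 := maxSpanningEquiangular_le_maxEquiangular n
  exact ⟨le_antisymm h2 (hle.trans (hN.trans h1)), Λ, hΛ, hX, hs,
    le_antisymm h1 (h2.trans (hle.trans hN))⟩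

theorem encard_minimalLines_eq_four {Λ : Submodule ℤ (EuclideanSpace ℝ (Fin 3))}
    (hΛ : IsFullLattice Λ) (hX : IsEquiangular (minimalLines Λ))
    (h4 : 4 ≤ (minimalLines Λ).encard) : (minimalLines Λ).encard = 4 :=
  (isTetrahedral_of_four_le (by simp) hΛ hX h4).isEquiangular_and_encard.2

theorem proposition2p2 :
    -- (1)
    (∀ n : ℕ, 2 ≤ n → n ≤ 7 →
      maxSpanningEquiangular n = maxEquiangular n ∧
      ((∃ Λ : Submodule ℤ (EuclideanSpace ℝ (Fin n)), IsFullLattice Λ ∧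
        IsEquiangular (minimalLines Λ) ∧ sSup (minimalLines Λ) = ⊤ ∧
        (minimalLines Λ).encard = maxSpanningEquiangular n) ↔ n ≠ 3)) ∧
    -- (2)
    (IsGreatest {k : ℕ∞ | ∃ Λ : Submodule ℤ (EuclideanSpace ℝ (Fin 3)), IsFullLattice Λ ∧
        IsEquiangular (minimalLines Λ) ∧ (minimalLines Λ).encard = k} 4 ∧
      ∀ Λ : Submodule ℤ (EuclideanSpace ℝ (Fin 3)), IsFullLattice Λ →
        ((IsEquiangular (minimalLines Λ) ∧ (minimalLines Λ).encard = 4) ↔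
          AreSimilar (minimalVectors (dualLattice (rootLatticeA 3))) (minimalVectors Λ))) ∧
    -- (3)
    (∀ n : ℕ, 8 ≤ n → n ≤ 13 →
      maxSpanningEquiangular n < maxEquiangular n ∧ maxEquiangular n = 28) := by
  refine ⟨fun n h2 h7 => ?_, ⟨⟨?_, ?_⟩, fun Λ hΛ => ⟨?_, ?_⟩⟩, fun n h8 h13 => ?_⟩
  · have of_lattice {n N : ℕ} (hn : n ≠ 3) (hle : maxEquiangular n ≤ N)
        (h : ∃ Λ : Submodule ℤ (EuclideanSpace ℝ (Fin n)), IsFullLattice Λ ∧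
          IsEquiangular (minimalLines Λ) ∧ sSup (minimalLines Λ) = ⊤ ∧
          (N : ℕ∞) ≤ (minimalLines Λ).encard) :=
      (maxSpanningEquiangular_eq_of_lattice hle h).imp_right fun h => iff_of_true h hn
    interval_cases n
    · exact of_lattice (by norm_num) maxEquiangular_two_le exists_lattice_two
    · refine ⟨le_antisymm (maxSpanningEquiangular_le_maxEquiangular 3)
        (maxEquiangular_three_le.trans six_le_maxSpanningEquiangular_three), iff_of_false ?_
        (by simp)⟩
      rintro ⟨Λ, hΛ, hX, -, h⟩
      have h6 : 6 ≤ (minimalLines Λ).encard := h ▸ six_le_maxSpanningEquiangular_three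
      rw [encard_minimalLines_eq_four hΛ hX (le_trans (by norm_num) h6)] at h6
      norm_num at h6
    · exact of_lattice (by norm_num) maxEquiangular_four_le exists_lattice_four
    · exact of_lattice (by norm_num) maxEquiangular_five_le exists_lattice_five
    · exact of_lattice (by norm_num) maxEquiangular_six_le exists_lattice_six
    · exact of_lattice (by norm_num) maxEquiangular_seven_le exists_lattice_seven
  · obtain ⟨Λ, hΛ, hX, -, h⟩ := exists_lattice_three
    exact ⟨Λ, hΛ, hX, encard_minimalLines_eq_four hΛ hX h⟩
  · rintro _ ⟨Λ, hΛ, hX, rfl⟩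
    by_contra! h
    exact h.ne' (encard_minimalLines_eq_four hΛ hX h.le)
  · rintro ⟨hX, h⟩
    exact isTetrahedral_dual_rootLatticeA.areSimilar (finrank_sumZeroSpace 3) (by simp)
      (isTetrahedral_of_four_le (by simp) hΛ hX h.ge)
  · exact fun h => (isTetrahedral_dual_rootLatticeA.of_areSimilar h).isEquiangular_and_encard
  · have h28 : maxEquiangular n = 28 := by
      refine le_antisymm (maxEquiangular_le_twenty_eight (by omega) h13) ?_
      obtain ⟨Λ, -, hX, -, h⟩ := exists_lattice_seven
      exact h.trans (hX.encard_le_maxEquiangular.trans (maxEquiangular_mono (by omega)))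
    exact ⟨h28 ▸ maxSpanningEquiangular_lt h8 h13, h28⟩
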